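/- Let $n,m\ge 1$ be integers. Points of $\mathbb R^n$ carry the Euclidean norm; $D^kf$ denotes the $k$-th weak derivative of a real function $f$, a function with values in the $k$-linear forms on $\mathbb R^n$, and $|D^kf(x)|$ its operator norm. For $1\le p\le\infty$, $W^{k,p}(\mathbb R^n)$ is the space of real $f\in L^p(\mathbb R^n)$ whose weak derivatives $D^jf$, $j\le k$, exist and lie in $L^p(\mathbb R^n)$ (so $W^{0,p}=L^p$). For $f\in W^{m-1,p}(\mathbb R^n)$ let $F=(f_0,\dots,f_{m-1})$ be any jet representing $f$, i.e. $f_0=f$ everywhere and $f_j$ is a representative of $D^jf$ for $1\le j\le m-1$. Put $$R^{m-1}f(y,x)=f(y)-\sum_{j=0}^{m-1}\frac{1}{j!}\,f_j(x)(y-x,\dots,y-x),$$ $$MQ^m_Rf(x)=\sup_{0<r\le R}\frac1{|B(x,r)|}\int_{B(x,r)}\frac{|R^{m-1}f(z,x)|}{|z-x|^m}\,dz\in[0,\infty]\quad(0<R<\infty),$$ $$MQ^m_\infty f(x)=MQ^mf(x)=\sup_{R>0}MQ^m_Rf(x).$$ **Proposition.** There is a constant $C$ depending only on $n$ and $m$,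 and for every $1<p\le\infty$ there is a constant $C'$ depending only on $n,m,p$, such that for every $f\in W^{m-1,p}(\mathbb R^n)$, every jet $F$ representing $f$ and every $0<R\le\infty$ the following hold. 1. $f\in W^{m,p}(\mathbb R^n)$ if and only if $MQ^m_Rf\in L^p(\mathbb R^n)$. 2. If $f$ has a (locally integrable) weak derivative $D^mf$, then $$\|D^mf\|_{L^p}\le C\,\|MQ^m_Rf\|_{L^p}\quad\text{and}\quad \|MQ^m_Rf\|_{L^p}\le C'\,\|D^mf\|_{L^p}$$ (norms with values in $[0,\infty]$). 3. For all $x,y\in\mathbb R^n$ with $|x-y|\le R$, $$|R^{m-1}f(y,x)|\le C\,|x-y|^m\,\bigl(MQ^m_Rf(x)+MQ^m_Rf(y)\bigr),$$ where the right-hand side is read as $0$ when $x=y$. -/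

import Mathlib

open MeasureTheory
open scoped ENNReal NNReal ContDiff

noncomputable section

namespace MeanQuotient

/-- The Euclidean space `ℝⁿ`. -/
abbrev Eucl (n : ℕ) : Type := EuclideanSpace ℝ (Fin n)

/-- `g`, with values in the `k`-linear forms on `ℝⁿ`, is the `k`-th weak (distributional) derivative
of `f`: both are locally integrable and
`∫ f(x) Dᵏφ(x)(v₁, …, v_k) dx = (-1)ᵏ ∫ φ(x) g(x)(v₁, …, v_k) dx`
for all test functions `φ ∈ C_c^∞(ℝⁿ)` and all vectors `v₁, …, v_k`. -/
structure HasWeakDeriv {n : ℕ} (k : ℕ) (f : Eucl n → ℝ)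
    (g : Eucl n → ContinuousMultilinearMap ℝ (fun _ : Fin k => Eucl n) ℝ) : Prop where
  locallyIntegrable : LocallyIntegrable f volume
  locallyIntegrable_deriv : LocallyIntegrable g volume
  integral_eq : ∀ φ : Eucl n → ℝ, ContDiff ℝ ∞ φ → HasCompactSupport φ → ∀ v : Fin k → Eucl n,
    ∫ x, f x * iteratedFDeriv ℝ k φ x v = (-1 : ℝ) ^ k * ∫ x, φ x * g x v

/-- Membership in the Sobolev space `W^{k,p}(ℝⁿ)`: `f ∈ L^p`, and `f` has weak derivatives of all
orders `j ≤ k`, which belong to `L^p`. -/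
def MemSobolev {n : ℕ} (k : ℕ) (p : ℝ≥0∞) (f : Eucl n → ℝ) : Prop :=
  MemLp f p volume ∧
    ∀ j ≤ k, ∃ g : Eucl n → ContinuousMultilinearMap ℝ (fun _ : Fin j => Eucl n) ℝ,
      HasWeakDeriv j f g ∧ MemLp g p volume

/-- `F` represents `f` as its `k`-jet `(f, Df, …, Dᵏf)` of weak derivatives: `f₀ = f` everywhere, and
`f_j = F · j` is (a representative of) the `j`-th weak derivative of `f` for `j ≤ k`.
The components of order larger than `k` are irrelevant. -/
def IsWeakJet {n : ℕ} (k : ℕ) (f : Eucl n → ℝ)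
    (F : Eucl n → FormalMultilinearSeries ℝ (Eucl n) ℝ) : Prop :=
  (∀ x, F x 0 0 = f x) ∧ ∀ j ≤ k, HasWeakDeriv j f (fun x => F x j)

/-- The Taylor field `TᵏF(y, x) = ∑_{j ≤ k} f_j(x) (y - x)^j / j!` of a jet `F`. -/
def taylorField {n : ℕ} (k : ℕ) (F : Eucl n → FormalMultilinearSeries ℝ (Eucl n) ℝ)
    (y x : Eucl n) : ℝ :=
  ∑ j ∈ Finset.range (k + 1), F x j (fun _ => y - x) / (j.factorial : ℝ)

/-- The Taylor–Whitney remainder `RᵏF(y, x) = f₀(y) - TᵏF(y, x)` of a jet `F`. -/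
def taylorRemainder {n : ℕ} (k : ℕ) (F : Eucl n → FormalMultilinearSeries ℝ (Eucl n) ℝ)
    (y x : Eucl n) : ℝ :=
  F y 0 0 - taylorField k F y x

/-- The `m`-th order (`m ≥ 1`) restricted maximal mean quotient
`sup_{0 < r ≤ R} ⨍_{B(x,r)} |R^{m-1}F(z, x)| / |z - x|^m dz`, with values in `[0, ∞]`. -/
def restrictedMeanQuotient {n : ℕ} (m : ℕ) (R : ℝ)
    (F : Eucl n → FormalMultilinearSeries ℝ (Eucl n) ℝ) (x : Eucl n) : ℝ≥0∞ :=
  ⨆ (r : ℝ) (_ : 0 < r) (_ : r ≤ R),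
    ⨍⁻ z in Metric.ball x r, ‖taylorRemainder (m - 1) F z x‖ₑ / ‖z - x‖ₑ ^ m ∂volume

/-- The `m`-th order maximal mean quotient: the supremum over `R > 0` of the restricted ones. -/
def maximalMeanQuotient {n : ℕ} (m : ℕ)
    (F : Eucl n → FormalMultilinearSeries ℝ (Eucl n) ℝ) (x : Eucl n) : ℝ≥0∞ :=
  ⨆ (R : ℝ) (_ : 0 < R), restrictedMeanQuotient m R F x

end MeanQuotient

end

/-!
A mean quotient and a top derivative control each other through mollification.

*From the mean quotient to the derivative.* Let `η_r` be a smooth mollifier supported in the ball of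
radius `r`. The derivatives of order `m` of `η_r` annihilate polynomials of degree less than `m`, so
in `D^m (f ∗ η_r)(x) = ∫ f(z) D^m η_r(x - z) dz` the function `f` may be replaced by its Taylor
remainder at `x`. As `|D^m η_r| ≤ A r^{-n-m}`, the derivative `D^m (f ∗ η_r)(x)` is bounded, at
every point `x`, by the average of the remainder quotient over `B(x, r)`
(`exists_enorm_integral_mul_iteratedFDeriv_mollifier_le`). If `D^m f` exists, letting `r → 0` gives
the first inequality between the norms. If instead the mean quotient is only known to be in `L^p`,
the functions `D^m (f ∗ η_r)`, for small `r`, are dominated by one locally integrable function. A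
weighted `L²` space, in which the domination becomes a norm bound, provides weak limits of the
components (`exists_integral_mul_eq_of_tendsto`), and these limits form the weak derivative
(`exists_hasWeakDeriv_of_dominated`). All of this uses small radii only, hence works for any `R`.

*From the derivative to the mean quotient.* For the mollified function, Taylor's theorem along the
segment from `x` to `z`, together with Fubini, bounds the averages of the remainder quotient by
averages of `|D^m f|`, hence by a mollification of the Hardy–Littlewood maximal function of
`|D^m f|`. Fatou's lemma removes the mollification (`ae_maximalMeanQuotient_le_maximalFunction`), and
the maximal inequality (`exists_eLpNorm_maximalFunction_le`) is the place where `p > 1` is needed.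

*The pointwise inequality.* The difference of the Taylor polynomials at `x` and at `y` has degree
less than `m`, so its `m`-th finite differences vanish; its value at `y`, which is the remainder up
to sign, is therefore a combination of its values at `y + h, …, y + m h`, where it is the difference
of two remainders. Averaging over a ball of increments `h` which keeps all these points in both
balls of radius `|x - y|` gives the claim (`exists_enorm_taylorRemainder_le`).
-/

namespace MeanQuotient

/-! ### The Hardy–Littlewood maximal function -/

section MaximalFunction

open Metric Set Module

variable {E : Type*} [NormedAddCommGroup E] [MeasurableSpace E]

/-- The centred Hardy–Littlewood maximal function
`x ↦ sup_{r > 0} ⨍_{B(x,r)} g` of a nonnegative function. -/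
noncomputable def maximalFunction (μ : Measure E) (g : E → ℝ≥0∞) (x : E) : ℝ≥0∞ :=
  ⨆ (r : ℝ) (_ : 0 < r), ⨍⁻ z in ball x r, g z ∂μ

theorem setLAverage_ball_le_maximalFunction (μ : Measure E) (g : E → ℝ≥0∞) (x : E) {r : ℝ}
    (hr : 0 < r) : ⨍⁻ z in ball x r, g z ∂μ ≤ maximalFunction μ g x :=
  le_iSup₂ (f := fun (r : ℝ) (_ : 0 < r) => ⨍⁻ z in ball x r, g z ∂μ) r hr

theorem maximalFunction_congr_ae {μ : Measure E} {g h : E → ℝ≥0∞} (hgh : g =ᵐ[μ] h) :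
    maximalFunction μ g = maximalFunction μ h := by
  funext x
  simp only [maximalFunction, setLAverage_eq]
  congr! 4
  exact lintegral_congr_ae (ae_restrict_of_ae hgh)

theorem maximalFunction_le_add_const (μ : Measure E) {g h : E → ℝ≥0∞} {c : ℝ≥0∞}
    (hgh : ∀ x, g x ≤ h x + c) (x : E) :
    maximalFunction μ g x ≤ maximalFunction μ h x + c := by
  refine iSup₂_le fun r hr => ?_
  refine le_trans ?_ (add_le_add_left (setLAverage_ball_le_maximalFunction μ h x hr) c)
  simp only [setLAverage_eq]
  calc (∫⁻ z in ball x r, g z ∂μ) / μ (ball x r)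
      ≤ (∫⁻ z in ball x r, (h z + c) ∂μ) / μ (ball x r) := by gcongr; exact hgh _
    _ = (∫⁻ z in ball x r, h z ∂μ) / μ (ball x r) + c * μ (ball x r) / μ (ball x r) := by
        rw [lintegral_add_right _ measurable_const, ENNReal.add_div]; simp
    _ ≤ _ := by
        gcongr
        exact ENNReal.div_le_of_le_mul le_rfl

/-- An average over `B(x,r)` is approximated from below by averages over balls of smaller rational
radius, so the supremum over an interval of radii is a countable one. -/
theorem iSup_setLAverage_ball_eq_iSup_rat (μ : Measure E) (g : E → ℝ≥0∞) (x : E) {S : Set ℝ}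
    (hS : ∀ r ∈ S, ∀ q, 0 < q → q < r → q ∈ S) :
    ⨆ (r : ℝ) (_ : 0 < r) (_ : r ∈ S), ⨍⁻ z in ball x r, g z ∂μ
      = ⨆ (q : ℚ) (_ : 0 < (q : ℝ)) (_ : (q : ℝ) ∈ S), ⨍⁻ z in ball x (q : ℝ), g z ∂μ := by
  apply le_antisymm
  · refine iSup_le fun r => iSup_le fun hr => iSup_le fun hrS => ?_
    have hball : ball x r = ⋃ q : {q : ℚ // 0 < (q : ℝ) ∧ (q : ℝ) < r}, ball x (q : ℝ) := by
      ext z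
      simp only [mem_ball, mem_iUnion]
      constructor
      · intro hz
        obtain ⟨q, hq1, hq2⟩ := exists_rat_btwn hz
        exact ⟨⟨q, dist_nonneg.trans_lt hq1, hq2⟩, hq1⟩
      · rintro ⟨q, hq⟩
        exact hq.trans q.2.2
    have hdir : Directed (· ⊆ ·)
        fun q : {q : ℚ // 0 < (q : ℝ) ∧ (q : ℝ) < r} => ball x (q : ℝ) := by
      apply Monotone.directed_le
      intro a b hab
      exact ball_subset_ball (by exact_mod_cast hab)
    rw [setLAverage_eq]
    conv_lhs => enter [1]; rw [hball]
    rw [setLIntegral_iUnion_of_directed _ hdir, ENNReal.iSup_div]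
    refine iSup_le fun q => ?_
    refine le_iSup_of_le q.1 (le_iSup_of_le q.2.1
      (le_iSup_of_le (hS r hrS _ q.2.1 q.2.2) ?_))
    rw [setLAverage_eq]
    exact ENNReal.div_le_div_left (measure_mono (ball_subset_ball q.2.2.le)) _
  · exact iSup_le fun q => iSup_le fun hq => iSup_le fun hqS =>
      le_iSup_of_le (q : ℝ) (le_iSup_of_le hq (le_iSup_of_le hqS le_rfl))

variable [NormedSpace ℝ E] [BorelSpace E] [FiniteDimensional ℝ E]

theorem measurable_setLAverage_ball (μ : Measure E) [μ.IsAddHaarMeasure] {k : E → E → ℝ≥0∞}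
    (hk : Measurable (Function.uncurry k)) (r : ℝ) :
    Measurable fun x => ⨍⁻ z in ball x r, k x z ∂μ := by
  simp only [setLAverage_eq, Measure.addHaar_ball_center]
  refine Measurable.div_const ?_ _
  have h : Measurable fun x : E =>
      ∫⁻ z, {p : E × E | dist p.2 p.1 < r}.indicator (Function.uncurry k) (x, z) ∂μ := by
    apply Measurable.lintegral_prod_right'
      (f := {p : E × E | dist p.2 p.1 < r}.indicator (Function.uncurry k))
    exact hk.indicator (measurableSet_lt (measurable_snd.dist measurable_fst) measurable_const)
  convert h using 2 with x
  rw [← lintegral_indicator measurableSet_ball]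
  rfl

theorem measurable_iSup_setLAverage_ball (μ : Measure E) [μ.IsAddHaarMeasure]
    {k : E → E → ℝ≥0∞} (hk : Measurable (Function.uncurry k)) {S : Set ℝ}
    (hS : ∀ r ∈ S, ∀ q, 0 < q → q < r → q ∈ S) :
    Measurable fun x => ⨆ (r : ℝ) (_ : 0 < r) (_ : r ∈ S), ⨍⁻ z in ball x r, k x z ∂μ := by
  simp only [fun x => iSup_setLAverage_ball_eq_iSup_rat μ (k x) x hS]
  exact Measurable.iSup fun q => Measurable.iSup fun _ => Measurable.iSup fun _ =>
    measurable_setLAverage_ball μ hk q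

theorem measurable_maximalFunction (μ : Measure E) [μ.IsAddHaarMeasure] {g : E → ℝ≥0∞}
    (hg : AEMeasurable g μ) : Measurable (maximalFunction μ g) := by
  rw [maximalFunction_congr_ae hg.ae_eq_mk]
  have := measurable_iSup_setLAverage_ball μ (k := fun _ z => hg.mk g z)
    (hg.measurable_mk.comp measurable_snd) (S := univ) (by simp)
  simp only [mem_univ, iSup_pos] at this
  exact this

/-- The weak type `(1,1)` inequality, by Vitali's covering lemma. The radii are bounded by a
natural number at first, which is removed by monotone exhaustion of the superlevel set. -/
theorem mul_measure_lt_maximalFunction_le (μ : Measure E) [μ.IsAddHaarMeasure] (g : E → ℝ≥0∞)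
    (c : ℝ≥0∞) :
    c * μ {x | c < maximalFunction μ g x} ≤ 5 ^ finrank ℝ E * ∫⁻ x, g x ∂μ := by
  set S : ℕ → Set E := fun N =>
    {x | ∃ r : ℝ, 0 < r ∧ r ≤ N ∧ c < ⨍⁻ z in ball x r, g z ∂μ} with hSdef
  have hunion : {x | c < maximalFunction μ g x} = ⋃ N, S N := by
    ext x
    simp only [mem_ofPred_eq, mem_iUnion, hSdef, maximalFunction, lt_iSup_iff]
    constructor
    · rintro ⟨r, hr, h⟩
      obtain ⟨N, hN⟩ := exists_nat_ge r
      exact ⟨N, r, hr, hN, h⟩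
    · rintro ⟨N, r, hr, -, h⟩
      exact ⟨r, hr, h⟩
  have hmono : Monotone S := by
    rintro a b hab x ⟨r, hr, hra, h⟩
    exact ⟨r, hr, hra.trans (by exact_mod_cast hab), h⟩
  rw [hunion, hmono.directed_le.measure_iUnion, ENNReal.mul_iSup]
  refine iSup_le fun N => ?_
  have hex : ∀ x : E, ∃ r : ℝ, x ∈ S N → 0 < r ∧ r ≤ N ∧ c < ⨍⁻ z in ball x r, g z ∂μ := by
    intro x
    by_cases hx : x ∈ S N
    · obtain ⟨r, h⟩ := hx
      exact ⟨r, fun _ => h⟩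
    · exact ⟨0, fun h => absurd h hx⟩
  choose r hr using hex
  obtain ⟨u, huS, hdisj, hcov⟩ := Vitali.exists_disjoint_subfamily_covering_enlargement_closedBall
    (S N) id r N (fun a ha => (hr a ha).2.1) 4 (by norm_num)
  have hdisj' : u.PairwiseDisjoint fun a => ball a (r a) :=
    hdisj.mono fun a => ball_subset_closedBall
  have hcount : u.Countable := hdisj'.countable_of_isOpen (fun a _ => isOpen_ball)
    fun a ha => ⟨a, mem_ball_self (hr a (huS ha)).1⟩
  have hsub : S N ⊆ ⋃ b ∈ u, ball b (5 * r b) := by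
    intro a ha
    obtain ⟨b, hb, hab⟩ := hcov a ha
    have h1 : a ∈ closedBall b (4 * r b) := hab (mem_closedBall_self (hr a ha).1.le)
    have hrb := (hr b (huS hb)).1
    exact mem_biUnion hb (closedBall_subset_ball (by linarith) h1)
  have hball : ∀ b ∈ u, c * μ (ball b (5 * r b))
      ≤ 5 ^ finrank ℝ E * ∫⁻ z in ball b (r b), g z ∂μ := by
    intro b hb
    obtain ⟨hrb, -, h⟩ := hr b (huS hb)
    rw [setLAverage_eq] at h
    have h2 : c * μ (ball b (r b)) ≤ ∫⁻ z in ball b (r b), g z ∂μ :=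
      ENNReal.mul_le_of_le_div h.le
    rw [Measure.addHaar_ball_mul_of_pos μ b (by norm_num : (0 : ℝ) < 5),
      ← Measure.addHaar_ball_center μ b (r b), ENNReal.ofReal_pow (by norm_num), mul_left_comm]
    simp only [ENNReal.ofReal_ofNat]
    gcongr
  have := hcount.to_subtype
  calc c * μ (S N) ≤ c * μ (⋃ b ∈ u, ball b (5 * r b)) := by gcongr
    _ ≤ c * ∑' b : u, μ (ball (b : E) (5 * r b)) := by
        gcongr; exact measure_biUnion_le μ hcount _
    _ = ∑' b : u, c * μ (ball (b : E) (5 * r b)) := ENNReal.tsum_mul_left.symm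
    _ ≤ ∑' b : u, 5 ^ finrank ℝ E * ∫⁻ z in ball (b : E) (r b), g z ∂μ :=
        ENNReal.tsum_le_tsum fun b => hball b b.2
    _ = 5 ^ finrank ℝ E * ∑' b : u, ∫⁻ z in ball (b : E) (r b), g z ∂μ := ENNReal.tsum_mul_left
    _ = 5 ^ finrank ℝ E * ∫⁻ z in ⋃ b ∈ u, ball b (r b), g z ∂μ := by
        rw [lintegral_biUnion hcount (fun _ _ => measurableSet_ball) hdisj']
    _ ≤ 5 ^ finrank ℝ E * ∫⁻ x, g x ∂μ := by gcongr; exact Measure.restrict_le_self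

/-- Splitting `g` at height `c / 2`, only its large part contributes to the superlevel set of the
maximal function at height `c`. -/
theorem mul_measure_lt_maximalFunction_le_setLIntegral (μ : Measure E) [μ.IsAddHaarMeasure]
    {g : E → ℝ≥0∞} (hg : Measurable g) (c : ℝ≥0∞) :
    c * μ {x | c < maximalFunction μ g x}
      ≤ 2 * 5 ^ finrank ℝ E * ∫⁻ x in {x | c < 2 * g x}, g x ∂μ := by
  set h : E → ℝ≥0∞ := {x | c < 2 * g x}.indicator g
  have hms : MeasurableSet {x | c < 2 * g x} := measurableSet_lt measurable_const (hg.const_mul 2)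
  have hgh : ∀ x, g x ≤ h x + c / 2 := by
    intro x
    by_cases hx : c < 2 * g x
    · simp only [h, indicator_of_mem (s := {x | c < 2 * g x}) hx]; exact le_self_add
    · simp only [h, indicator_of_notMem (s := {x | c < 2 * g x}) hx, zero_add]
      rw [ENNReal.le_div_iff_mul_le (by simp) (by simp), mul_comm]
      exact not_lt.1 hx
  have hsub : {x | c < maximalFunction μ g x} ⊆ {x | c / 2 < maximalFunction μ h x} := by
    intro x hx
    rw [mem_ofPred_eq] at hx ⊢
    have h1 := hx.trans_le (maximalFunction_le_add_const μ hgh x)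
    by_contra hcon
    have : c < c / 2 + c / 2 := h1.trans_le (add_le_add_left (not_lt.1 hcon) _)
    rw [ENNReal.add_halves] at this
    exact lt_irrefl _ this
  calc c * μ {x | c < maximalFunction μ g x}
      ≤ c * μ {x | c / 2 < maximalFunction μ h x} := by gcongr
    _ = 2 * (c / 2 * μ {x | c / 2 < maximalFunction μ h x}) := by
        rw [← mul_assoc, ENNReal.mul_div_cancel (by simp) (by simp)]
    _ ≤ 2 * (5 ^ finrank ℝ E * ∫⁻ x, h x ∂μ) := by
        exact mul_le_mul_right (mul_measure_lt_maximalFunction_le μ h _) _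
    _ = _ := by rw [mul_assoc, lintegral_indicator hms]

theorem lintegral_Ioi_rpow_sub_two_indicator {p : ℝ} (hp : 1 < p) {a : ℝ} (ha : 0 ≤ a) :
    ∫⁻ t in Ioi (0 : ℝ), (Iio a).indicator (fun t => ENNReal.ofReal (t ^ (p - 2))) t
      = ENNReal.ofReal (a ^ (p - 1) / (p - 1)) := by
  rw [lintegral_indicator measurableSet_Iio, Measure.restrict_restrict measurableSet_Iio,
    inter_comm, Ioi_inter_Iio, restrict_Ioo_eq_restrict_Ioc]
  have hint := (intervalIntegral.intervalIntegrable_rpow' (a := 0) (b := a) (r := p - 2)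
    (by linarith))
  rw [intervalIntegrable_iff_integrableOn_Ioc_of_le ha] at hint
  rw [← ofReal_integral_eq_lintegral_ofReal hint, ← intervalIntegral.integral_of_le ha,
    integral_rpow (Or.inl (by linarith))]
  · rw [Real.zero_rpow (by linarith)]
    congr 2 <;> ring_nf
  · filter_upwards [ae_restrict_mem measurableSet_Ioc] with t ht
    exact Real.rpow_nonneg ht.1.le _

/-- The Hardy–Littlewood maximal inequality for finite exponents: integrate the weak type bound
against `p t ^ (p - 1) dt`. -/
theorem lintegral_maximalFunction_rpow_le (μ : Measure E) [μ.IsAddHaarMeasure] {p : ℝ}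
    (hp : 1 < p) {g : E → ℝ≥0∞} (hg : Measurable g) (hgp : ∫⁻ x, g x ^ p ∂μ ≠ ⊤) :
    ∫⁻ x, maximalFunction μ g x ^ p ∂μ
      ≤ ENNReal.ofReal p * (2 * 5 ^ finrank ℝ E) * ENNReal.ofReal (2 ^ (p - 1) / (p - 1))
        * ∫⁻ x, g x ^ p ∂μ := by
  have hp0 : 0 < p := by linarith
  set K : ℝ≥0∞ := 2 * 5 ^ finrank ℝ E with hK
  have hKtop : K ≠ ⊤ := by finiteness
  have hM := measurable_maximalFunction μ hg.aemeasurable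
  have hgfin : ∀ᵐ x ∂μ, g x < ⊤ := by
    filter_upwards [ae_lt_top (hg.pow_const p) hgp] with x hx
    exact (ENNReal.rpow_lt_top_iff_of_pos hp0).1 hx
  -- The bound `t μ {M g > t} ≤ K ∫_{2 g > t} g ≤ K t (2 / t) ^ p ∫ g ^ p` forces `M g < ⊤` a.e.
  have hMfin : ∀ᵐ x ∂μ, maximalFunction μ g x < ⊤ := by
    have hbound : ∀ n : ℕ, μ {x | maximalFunction μ g x = ⊤}
        ≤ (K * (2 ^ (p - 1) * ∫⁻ x, g x ^ p ∂μ)) / ((n : ℝ≥0∞) + 1) ^ p := by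
      intro n
      set c : ℝ≥0∞ := (n : ℝ≥0∞) + 1 with hc
      have hc0 : c ≠ 0 := by simp [hc]
      have hct : c ≠ ⊤ := by simp [hc]
      rw [ENNReal.le_div_iff_mul_le (Or.inl (by simp [hc0, hct]))
        (Or.inl (ENNReal.rpow_ne_top_of_nonneg hp0.le hct))]
      have h1 : μ {x | maximalFunction μ g x = ⊤} ≤ μ {x | c < maximalFunction μ g x} :=
        measure_mono fun x hx => by
          rw [mem_ofPred_eq] at hx ⊢; rw [hx]; exact hct.lt_top
      have h2 := mul_measure_lt_maximalFunction_le_setLIntegral μ hg c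
      have hpow : c ^ p = c ^ (p - 1) * c := by
        conv_rhs => rw [← ENNReal.rpow_one c, ← ENNReal.rpow_mul, one_mul]
        rw [← ENNReal.rpow_add _ _ hc0 hct]; congr 1; ring
      have h3 : c ^ (p - 1) * ∫⁻ x in {x | c < 2 * g x}, g x ∂μ
          ≤ 2 ^ (p - 1) * ∫⁻ x, g x ^ p ∂μ := by
        rw [← lintegral_const_mul _ hg, ← lintegral_const_mul _ (hg.pow_const p)]
        refine (setLIntegral_mono ((hg.pow_const p).const_mul _) fun x hx => ?_).trans
          (setLIntegral_le_lintegral _ _)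
        calc c ^ (p - 1) * g x ≤ (2 * g x) ^ (p - 1) * g x := by
              gcongr; rw [mem_ofPred_eq] at hx; exact hx.le
          _ = 2 ^ (p - 1) * (g x ^ (p - 1) * g x ^ (1 : ℝ)) := by
              rw [ENNReal.mul_rpow_of_nonneg _ _ (by linarith), mul_assoc, ENNReal.rpow_one]
          _ = 2 ^ (p - 1) * g x ^ p := by
              rw [← ENNReal.rpow_add_of_nonneg _ _ (by linarith) (by linarith)]
              congr 2; ring
      calc μ {x | maximalFunction μ g x = ⊤} * c ^ p
          ≤ μ {x | c < maximalFunction μ g x} * c ^ p := by gcongr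
        _ = c ^ (p - 1) * (c * μ {x | c < maximalFunction μ g x}) := by rw [hpow]; ring
        _ ≤ c ^ (p - 1) * (K * ∫⁻ x in {x | c < 2 * g x}, g x ∂μ) := by gcongr
        _ = K * (c ^ (p - 1) * ∫⁻ x in {x | c < 2 * g x}, g x ∂μ) := by ring
        _ ≤ _ := by gcongr
    have hlim : Filter.Tendsto (fun n : ℕ =>
        (K * (2 ^ (p - 1) * ∫⁻ x, g x ^ p ∂μ)) / ((n : ℝ≥0∞) + 1) ^ p) Filter.atTop
        (nhds 0) := by
      have h1 : Filter.Tendsto (fun n : ℕ => ((n : ℝ≥0∞) + 1) ^ p) Filter.atTop (nhds ⊤) := by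
        have := (ENNReal.continuous_rpow_const (y := p)).tendsto ⊤
        rw [ENNReal.top_rpow_of_pos hp0] at this
        refine this.comp ?_
        have h := (Filter.tendsto_add_atTop_iff_nat 1).2 ENNReal.tendsto_nat_nhds_top
        simpa using h
      have hne : K * (2 ^ (p - 1) * ∫⁻ x, g x ^ p ∂μ) ≠ ⊤ :=
        ENNReal.mul_ne_top hKtop (ENNReal.mul_ne_top
          (ENNReal.rpow_ne_top_of_nonneg (by linarith) (by simp)) hgp)
      have := ENNReal.Tendsto.const_div h1 (Or.inr hne)
      simpa using this
    have h0 : μ {x | maximalFunction μ g x = ⊤} = 0 :=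
      le_antisymm (ge_of_tendsto' hlim hbound) bot_le
    simp only [ae_iff, not_lt, top_le_iff]
    exact h0
  have hlhs : ∫⁻ x, maximalFunction μ g x ^ p ∂μ
      = ∫⁻ x, ENNReal.ofReal ((maximalFunction μ g x).toReal ^ p) ∂μ := by
    apply lintegral_congr_ae
    filter_upwards [hMfin] with x hx
    rw [← ENNReal.ofReal_rpow_of_nonneg ENNReal.toReal_nonneg hp0.le, ENNReal.ofReal_toReal hx.ne]
  rw [hlhs, lintegral_rpow_eq_lintegral_meas_lt_mul μ
    (Filter.Eventually.of_forall fun x => ENNReal.toReal_nonneg) hM.ennreal_toReal.aemeasurable hp0]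
  have hkey : ∀ t ∈ Ioi (0 : ℝ), μ {x | t < (maximalFunction μ g x).toReal}
        * ENNReal.ofReal (t ^ (p - 1))
      ≤ K * ∫⁻ x, g x * (Iio (2 * (g x).toReal)).indicator
          (fun t => ENNReal.ofReal (t ^ (p - 2))) t ∂μ := by
    intro t ht
    rw [mem_Ioi] at ht
    have h1 : μ {x | t < (maximalFunction μ g x).toReal}
        ≤ μ {x | ENNReal.ofReal t < maximalFunction μ g x} := by
      refine measure_mono fun x hx => ?_
      rw [mem_ofPred_eq] at hx ⊢
      by_contra hcon
      exact absurd (ENNReal.toReal_le_of_le_ofReal ht.le (not_lt.1 hcon)) (not_le.2 hx)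
    have h2 : ENNReal.ofReal (t ^ (p - 1)) = ENNReal.ofReal (t ^ (p - 2)) * ENNReal.ofReal t := by
      rw [← ENNReal.ofReal_mul (Real.rpow_nonneg ht.le _)]
      congr 1
      conv_rhs => rw [← Real.rpow_one t, ← Real.rpow_mul ht.le, one_mul, ← Real.rpow_add ht]
      congr 1; ring
    calc _ ≤ μ {x | ENNReal.ofReal t < maximalFunction μ g x} * ENNReal.ofReal (t ^ (p - 1)) := by
          gcongr
      _ = ENNReal.ofReal (t ^ (p - 2))
            * (ENNReal.ofReal t * μ {x | ENNReal.ofReal t < maximalFunction μ g x}) := by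
          rw [h2]; ring
      _ ≤ ENNReal.ofReal (t ^ (p - 2))
            * (K * ∫⁻ x in {x | ENNReal.ofReal t < 2 * g x}, g x ∂μ) := by
          gcongr ENNReal.ofReal (t ^ (p - 2)) * ?_
          exact mul_measure_lt_maximalFunction_le_setLIntegral μ hg _
      _ = K * (ENNReal.ofReal (t ^ (p - 2))
            * ∫⁻ x in {x | ENNReal.ofReal t < 2 * g x}, g x ∂μ) := by
          ring
      _ = _ := by
          congr 1
          have hms : MeasurableSet {x | ENNReal.ofReal t < 2 * g x} :=
            measurableSet_lt measurable_const (hg.const_mul 2)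
          rw [← lintegral_indicator hms, ← lintegral_const_mul _ (hg.indicator hms)]
          apply lintegral_congr_ae
          filter_upwards [hgfin] with x hx
          have hiff : ENNReal.ofReal t < 2 * g x ↔ t < 2 * (g x).toReal := by
            rw [ENNReal.ofReal_lt_iff_lt_toReal ht.le (by finiteness)]
            simp
          by_cases hx' : t < 2 * (g x).toReal
          · rw [indicator_of_mem (s := {x | ENNReal.ofReal t < 2 * g x}) (hiff.2 hx'),
              indicator_of_mem (s := Iio (2 * (g x).toReal)) hx', mul_comm]
          · rw [indicator_of_notMem (s := {x | ENNReal.ofReal t < 2 * g x})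
              (fun h => hx' (hiff.1 h)),
              indicator_of_notMem (s := Iio (2 * (g x).toReal)) hx', mul_zero, mul_zero]
  have hmeas : Measurable fun q : ℝ × E => g q.2 * (Iio (2 * (g q.2).toReal)).indicator
      (fun t => ENNReal.ofReal (t ^ (p - 2))) q.1 := by
    refine (hg.comp measurable_snd).mul ?_
    have : (fun q : ℝ × E => (Iio (2 * (g q.2).toReal)).indicator
        (fun t => ENNReal.ofReal (t ^ (p - 2))) q.1)
        = {q : ℝ × E | q.1 < 2 * (g q.2).toReal}.indicator
          (fun q => ENNReal.ofReal (q.1 ^ (p - 2))) := rfl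
    rw [this]
    refine Measurable.indicator ?_ (measurableSet_lt measurable_fst
      ((hg.comp measurable_snd).ennreal_toReal.const_mul 2))
    exact ENNReal.measurable_ofReal.comp (measurable_fst.pow_const _)
  calc ENNReal.ofReal p * ∫⁻ t in Ioi (0 : ℝ), μ {x | t < (maximalFunction μ g x).toReal}
        * ENNReal.ofReal (t ^ (p - 1))
      ≤ ENNReal.ofReal p * ∫⁻ t in Ioi (0 : ℝ), K * ∫⁻ x, g x * (Iio (2 * (g x).toReal)).indicator
          (fun t => ENNReal.ofReal (t ^ (p - 2))) t ∂μ := by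
        gcongr ENNReal.ofReal p * ?_
        exact setLIntegral_mono' measurableSet_Ioi hkey
    _ = ENNReal.ofReal p * (K * ∫⁻ x, (∫⁻ t in Ioi (0 : ℝ), g x * (Iio (2 * (g x).toReal)).indicator
          (fun t => ENNReal.ofReal (t ^ (p - 2))) t) ∂μ) := by
        rw [lintegral_const_mul' _ _ hKtop, lintegral_lintegral_swap hmeas.aemeasurable]
    _ = ENNReal.ofReal p * (K * ∫⁻ x, ENNReal.ofReal (2 ^ (p - 1) / (p - 1)) * g x ^ p ∂μ) := by
        congr 2
        apply lintegral_congr_ae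
        filter_upwards [hgfin] with x hx
        rw [lintegral_const_mul' _ _ hx.ne, lintegral_Ioi_rpow_sub_two_indicator hp (by positivity),
          Real.mul_rpow (by norm_num) ENNReal.toReal_nonneg, mul_div_right_comm,
          ENNReal.ofReal_mul (by
            have : 0 < p - 1 := by linarith
            positivity),
          ← ENNReal.ofReal_rpow_of_nonneg ENNReal.toReal_nonneg (by linarith),
          ENNReal.ofReal_toReal hx.ne, mul_left_comm]
        congr 1
        conv_lhs => enter [1]; rw [← ENNReal.rpow_one (g x)]
        rw [← ENNReal.rpow_add_of_nonneg _ _ (by linarith) (by linarith)]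
        congr 1; ring
    _ = _ := by
        rw [lintegral_const_mul _ (hg.pow_const p)]
        ring

/-- The **Hardy–Littlewood maximal inequality**. -/
theorem exists_eLpNorm_maximalFunction_le (μ : Measure E) [μ.IsAddHaarMeasure] {p : ℝ≥0∞}
    (hp : 1 < p) : ∃ C : ℝ≥0, 0 < C ∧ ∀ g : E → ℝ≥0∞, AEMeasurable g μ →
      eLpNorm (maximalFunction μ g) p μ ≤ C * eLpNorm g p μ := by
  rcases eq_or_ne p ⊤ with rfl | hpt
  · refine ⟨1, one_pos, fun g _ => ?_⟩
    simp only [eLpNorm_exponent_top, eLpNormEssSup, ENNReal.coe_one, one_mul, enorm_eq_self]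
    refine essSup_le_of_ae_le _ (Filter.Eventually.of_forall fun x => iSup₂_le fun r hr => ?_)
    rw [setLAverage_eq]
    refine ENNReal.div_le_of_le_mul ?_
    calc ∫⁻ z in ball x r, g z ∂μ ≤ ∫⁻ z in ball x r, essSup g μ ∂μ :=
          lintegral_mono_ae (ae_restrict_of_ae (ENNReal.ae_le_essSup g))
      _ = _ := by simp
  have hp1 : 1 < p.toReal := by
    rw [← ENNReal.toReal_one]
    exact (ENNReal.toReal_lt_toReal (by simp) hpt).2 hp
  have hp0 : 0 < p.toReal := by linarith
  have hp00 : p ≠ 0 := by rintro rfl; simp at hp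
  set K : ℝ≥0∞ := ENNReal.ofReal p.toReal * (2 * 5 ^ finrank ℝ E)
    * ENNReal.ofReal (2 ^ (p.toReal - 1) / (p.toReal - 1)) with hK
  have hKt : K ≠ ⊤ := by finiteness
  have hKt' : K ^ (1 / p.toReal) ≠ ⊤ := ENNReal.rpow_ne_top_of_nonneg (by positivity) hKt
  -- The summand `1` makes the constant positive, so that the bound is void if `g` is not in `L^p`.
  refine ⟨(K ^ (1 / p.toReal)).toNNReal + 1, by positivity, fun g hg => ?_⟩
  rw [maximalFunction_congr_ae hg.ae_eq_mk, eLpNorm_congr_ae hg.ae_eq_mk]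
  set h := hg.mk g
  have hh : Measurable h := hg.measurable_mk
  by_cases htop : eLpNorm h p μ = ⊤
  · rw [htop, ENNReal.mul_top (by simp)]
    exact le_top
  rw [eLpNorm_eq_lintegral_rpow_enorm_toReal hp00 hpt] at htop ⊢
  rw [eLpNorm_eq_lintegral_rpow_enorm_toReal hp00 hpt]
  simp only [enorm_eq_self] at htop ⊢
  have hfin : ∫⁻ x, h x ^ p.toReal ∂μ ≠ ⊤ := by
    intro h0
    rw [h0, ENNReal.top_rpow_of_pos (by positivity)] at htop
    exact htop rfl
  calc (∫⁻ x, maximalFunction μ h x ^ p.toReal ∂μ) ^ (1 / p.toReal)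
      ≤ (K * ∫⁻ x, h x ^ p.toReal ∂μ) ^ (1 / p.toReal) := by
        gcongr; exact lintegral_maximalFunction_rpow_le μ hp1 hh hfin
    _ = K ^ (1 / p.toReal) * (∫⁻ x, h x ^ p.toReal ∂μ) ^ (1 / p.toReal) :=
        ENNReal.mul_rpow_of_nonneg _ _ (by positivity)
    _ ≤ _ := by
        gcongr
        rw [ENNReal.coe_add, ENNReal.coe_toNNReal hKt']
        exact le_self_add

end MaximalFunction

/-! ### Iterated derivatives of smooth functions -/

section IteratedDerivatives

open Module

variable {E : Type*} [NormedAddCommGroup E] [NormedSpace ℝ E]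

theorem iteratedFDeriv_fderiv_apply {g : E → ℝ} (hg : ContDiff ℝ ∞ g) (k : ℕ) (x : E)
    (v : Fin (k + 1) → E) :
    iteratedFDeriv ℝ (k + 1) g x v
      = iteratedFDeriv ℝ k (fun y => fderiv ℝ g y (v (Fin.last k))) x (Fin.init v) := by
  rw [iteratedFDeriv_succ_apply_right]
  have h := (ContinuousLinearMap.apply ℝ ℝ (v (Fin.last k))).iteratedFDeriv_comp_left
    (f := fun y => fderiv ℝ g y) (x := x) (n := ∞) (i := k)
    (hg.fderiv_right (m := ∞) (by simp)).contDiffAt (by exact_mod_cast le_top)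
  have h2 := congrArg (fun A : ContinuousMultilinearMap ℝ (fun _ : Fin k => E) ℝ =>
    A (Fin.init v)) h
  exact h2.symm

theorem contDiff_fderiv_apply {f : E → ℝ} (hf : ContDiff ℝ ∞ f) (u : E) :
    ContDiff ℝ ∞ fun y => fderiv ℝ f y u :=
  (hf.fderiv_right (m := ∞) (by simp)).clm_apply contDiff_const

theorem fderiv_fderiv_apply_comm {f : E → ℝ} (hf : ContDiff ℝ ∞ f) (u w x : E) :
    fderiv ℝ (fun y => fderiv ℝ f y u) x w = fderiv ℝ (fun y => fderiv ℝ f y w) x u := by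
  have hd : DifferentiableAt ℝ (fderiv ℝ f) x :=
    (hf.fderiv_right (m := ∞) (by simp)).differentiable (by simp) x
  have hsymm : IsSymmSndFDerivAt ℝ f x := hf.contDiffAt.isSymmSndFDerivAt
    (by rw [minSmoothness_of_isRCLikeNormedField]
        exact WithTop.coe_le_coe.2 (le_top : (2 : ℕ∞) ≤ ⊤))
  have h : ∀ u w : E, fderiv ℝ (fun y => fderiv ℝ f y u) x w = fderiv ℝ (fderiv ℝ f) x w u := by
    intro u w
    rw [fderiv_clm_apply hd (differentiableAt_const u)]
    simp
  rw [h, h]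
  exact hsymm w u

/-- Directional derivatives commute with iterated derivatives of smooth functions. -/
theorem fderiv_iteratedFDeriv_apply {f : E → ℝ} (hf : ContDiff ℝ ∞ f) (k : ℕ) (x u : E)
    (w : Fin k → E) :
    fderiv ℝ (fun y => iteratedFDeriv ℝ k f y w) x u
      = iteratedFDeriv ℝ k (fun y => fderiv ℝ f y u) x w := by
  induction k generalizing f x with
  | zero => simp
  | succ k ih =>
    simp only [iteratedFDeriv_fderiv_apply hf, iteratedFDeriv_fderiv_apply
      (contDiff_fderiv_apply hf u), ih (contDiff_fderiv_apply hf _)]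
    simp only [fun y => fderiv_fderiv_apply_comm hf u (w (Fin.last k)) y]

theorem fderiv_iteratedFDeriv_apply_init {f : E → ℝ} (hf : ContDiff ℝ ∞ f) (k : ℕ) (x : E)
    (v : Fin (k + 1) → E) :
    fderiv ℝ (fun y => iteratedFDeriv ℝ k f y (Fin.init v)) x (v (Fin.last k))
      = iteratedFDeriv ℝ (k + 1) f x v := by
  rw [fderiv_iteratedFDeriv_apply hf, iteratedFDeriv_fderiv_apply hf]

theorem contDiff_iteratedFDeriv_apply {f : E → ℝ} (hf : ContDiff ℝ ∞ f) (k : ℕ)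
    (v : Fin k → E) : ContDiff ℝ ∞ fun x => iteratedFDeriv ℝ k f x v :=
  (ContinuousMultilinearMap.apply ℝ (fun _ : Fin k => E) ℝ v).contDiff.comp
    (hf.iteratedFDeriv_right (m := ∞) (i := k) (by exact_mod_cast le_top))

theorem hasCompactSupport_iteratedFDeriv_apply {f : E → ℝ} (hf : HasCompactSupport f) (k : ℕ)
    (v : Fin k → E) : HasCompactSupport fun x => iteratedFDeriv ℝ k f x v :=
  (hf.iteratedFDeriv k).comp_left
    (g := fun A : ContinuousMultilinearMap ℝ (fun _ : Fin k => E) ℝ => A v) rfl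

/-- Integration by parts for iterated derivatives. -/
theorem integral_mul_iteratedFDeriv_apply [MeasurableSpace E] [BorelSpace E]
    [FiniteDimensional ℝ E] (μ : Measure E) [μ.IsAddHaarMeasure] {f g : E → ℝ}
    (hf : ContDiff ℝ ∞ f) (hg : ContDiff ℝ ∞ g) (hgc : HasCompactSupport g) (k : ℕ)
    (v : Fin k → E) :
    ∫ x, f x * iteratedFDeriv ℝ k g x v ∂μ
      = (-1) ^ k * ∫ x, g x * iteratedFDeriv ℝ k f x v ∂μ := by
  induction k generalizing g with
  | zero => simp [mul_comm]
  | succ k ih =>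
    have hg' := contDiff_fderiv_apply hg (v (Fin.last k))
    have hgc' : HasCompactSupport fun y => fderiv ℝ g y (v (Fin.last k)) :=
      hgc.fderiv_apply ℝ _
    have hF := contDiff_iteratedFDeriv_apply hf k (Fin.init v)
    have hF' := contDiff_fderiv_apply hF (v (Fin.last k))
    simp only [iteratedFDeriv_fderiv_apply hg k _ v]
    rw [ih hg' hgc' (Fin.init v)]
    have hparts := integral_mul_fderiv_eq_neg_fderiv_mul_of_integrable (μ := μ)
      (f := fun y => iteratedFDeriv ℝ k f y (Fin.init v)) (g := g) (v := v (Fin.last k))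
      ((hF'.continuous.mul hg.continuous).integrable_of_hasCompactSupport hgc.mul_left)
      ((hF.continuous.mul hg'.continuous).integrable_of_hasCompactSupport hgc'.mul_left)
      ((hF.continuous.mul hg.continuous).integrable_of_hasCompactSupport hgc.mul_left)
      (fun x _ => hF.differentiable (by simp) x) (fun x _ => hg.differentiable (by simp) x)
    simp only [fderiv_iteratedFDeriv_apply_init hf k _ v] at hparts
    simp only [mul_comm (fderiv ℝ g _ _)]
    rw [hparts, pow_succ, mul_assoc, neg_one_mul]
    simp only [mul_comm (g _)]

theorem iteratedFDeriv_multilinear_diag_sub_eq_zero {j k : ℕ} (hjk : j < k)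
    (A : ContinuousMultilinearMap ℝ (fun _ : Fin j => E) ℝ) (x z : E) :
    iteratedFDeriv ℝ k (fun z => A fun _ => z - x) z = 0 := by
  have h0 : iteratedFDeriv ℝ k (fun w : Fin j → E => A w) = 0 := by
    have : IsEmpty (Fin k ↪ Fin j) := by
      exact Function.Embedding.isEmpty_of_card_lt (by simpa using hjk)
    rw [A.iteratedFDeriv_eq]
    funext w
    simp [ContinuousMultilinearMap.iteratedFDeriv]
  let L : E →L[ℝ] (Fin j → E) := ContinuousLinearMap.pi fun _ => ContinuousLinearMap.id ℝ E
  have h1 : (fun z => A fun _ => z - x) = fun z => ((fun w => A w) ∘ L) (z - x) := rfl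
  rw [h1, iteratedFDeriv_comp_sub, L.iteratedFDeriv_comp_right (n := ∞) A.contDiff _
    (by exact_mod_cast le_top), h0]
  ext v
  simp

theorem iteratedFDeriv_comp_const_sub {f : E → ℝ} (hf : ContDiff ℝ ∞ f) (k : ℕ) (x z : E)
    (v : Fin k → E) :
    iteratedFDeriv ℝ k (fun z => f (x - z)) z v = (-1) ^ k * iteratedFDeriv ℝ k f (x - z) v := by
  have h1 : (fun z => f (x - z)) = fun z => (fun y => f ((-1 : ℝ) • y)) (z - x) := by
    funext z; simp
  rw [h1, iteratedFDeriv_comp_sub (f := fun y => f ((-1 : ℝ) • y)),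
    iteratedFDeriv_comp_const_smul (-1 : ℝ)
    (hf.of_le (by exact_mod_cast le_top))]
  simp

end IteratedDerivatives

/-! ### Taylor fields of jets -/

section Jets

variable {n : ℕ}

theorem contDiff_taylorField (k : ℕ) (F : Eucl n → FormalMultilinearSeries ℝ (Eucl n) ℝ)
    (x : Eucl n) : ContDiff ℝ ∞ fun z => taylorField k F z x := by
  unfold taylorField
  refine ContDiff.sum fun j _ => ContDiff.div_const ?_ _
  exact (F x j).contDiff.comp (contDiff_pi.2 fun _ => contDiff_id.sub contDiff_const)

theorem iteratedFDeriv_taylorField_eq_zero (k : ℕ)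
    (F : Eucl n → FormalMultilinearSeries ℝ (Eucl n) ℝ) (x z : Eucl n) :
    iteratedFDeriv ℝ (k + 1) (fun z => taylorField k F z x) z = 0 := by
  have hterm : ∀ j : ℕ, ContDiff ℝ ∞ fun z : Eucl n => F x j fun _ => z - x := fun j =>
    (F x j).contDiff.comp (contDiff_pi.2 fun _ => contDiff_id.sub contDiff_const)
  have hsmul : ∀ j : ℕ, ContDiff ℝ (k + 1 : ℕ)
      ((j.factorial : ℝ)⁻¹ • fun z : Eucl n => F x j fun _ => z - x) := fun j =>
    ((hterm j).of_le (by exact_mod_cast le_top)).const_smul (j.factorial : ℝ)⁻¹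
  have h1 : (fun z => taylorField k F z x) = ∑ j ∈ Finset.range (k + 1),
      (j.factorial : ℝ)⁻¹ • fun z : Eucl n => F x j fun _ => z - x := by
    funext z
    simp [taylorField, div_eq_inv_mul]
  rw [h1, iteratedFDeriv_sum_apply fun j _ => (hsmul j).contDiffAt]
  refine Finset.sum_eq_zero fun j hj => ?_
  rw [iteratedFDeriv_const_smul_apply ((hterm j).contDiffAt.of_le (by exact_mod_cast le_top)),
    iteratedFDeriv_multilinear_diag_sub_eq_zero (by simpa using hj), smul_zero]

theorem taylorRemainder_self (k : ℕ) (F : Eucl n → FormalMultilinearSeries ℝ (Eucl n) ℝ)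
    (x : Eucl n) : taylorRemainder k F x x = 0 := by
  rw [taylorRemainder, taylorField, Finset.sum_eq_single 0]
  · rw [Subsingleton.elim (fun _ : Fin 0 => x - x) 0]; simp
  · intro j _ hj
    have : Nonempty (Fin j) := ⟨⟨0, Nat.pos_of_ne_zero hj⟩⟩
    rw [sub_self, (F x j).map_coord_zero (Classical.arbitrary (Fin j)) rfl, zero_div]
  · simp

end Jets

/-! ### Mollifiers -/

section Mollifiers

variable {n : ℕ}

/-- A smooth bump function at the origin supported in the closed ball of radius `r / 2`, hence
inside the open ball of radius `r`. The quotient of its radii does not depend on `r`. -/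
noncomputable def bump (n : ℕ) {r : ℝ} (hr : 0 < r) : ContDiffBump (0 : Eucl n) where
  rIn := r / 4
  rOut := r / 2
  rIn_pos := by positivity
  rIn_lt_rOut := by linarith

/-- The standard mollifier at scale `r`. -/
noncomputable def mollifier (n : ℕ) {r : ℝ} (hr : 0 < r) : Eucl n → ℝ :=
  (bump n hr).normed volume

theorem contDiff_mollifier {r : ℝ} (hr : 0 < r) : ContDiff ℝ ∞ (mollifier n hr) :=
  (bump n hr).contDiff_normed

theorem hasCompactSupport_mollifier {r : ℝ} (hr : 0 < r) :
    HasCompactSupport (mollifier n hr) :=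
  (bump n hr).hasCompactSupport_normed

theorem mollifier_nonneg {r : ℝ} (hr : 0 < r) (x : Eucl n) : 0 ≤ mollifier n hr x :=
  (bump n hr).nonneg_normed x

theorem mollifier_neg {r : ℝ} (hr : 0 < r) (x : Eucl n) :
    mollifier n hr (-x) = mollifier n hr x :=
  (bump n hr).normed_neg x

theorem iteratedFDeriv_mollifier_eq_zero {r : ℝ} (hr : 0 < r) (k : ℕ) {y : Eucl n}
    (hy : r ≤ ‖y‖) : iteratedFDeriv ℝ k (mollifier n hr) y = 0 := by
  by_contra h
  have h1 := support_iteratedFDeriv_subset (𝕜 := ℝ) k (Function.mem_support.2 h)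
  rw [mollifier, (bump n hr).tsupport_normed_eq] at h1
  have h2 : ‖y‖ ≤ (bump n hr).rOut := by simpa using h1
  have h3 : (bump n hr).rOut = r / 2 := rfl
  linarith

theorem bump_apply_eq_scale {r : ℝ} (hr : 0 < r) (y : Eucl n) :
    bump n hr y = bump n one_pos (r⁻¹ • y) := by
  rw [ContDiffBump.apply, ContDiffBump.apply]
  simp only [bump, sub_zero, smul_smul]
  have h1 : r / 2 / (r / 4) = 1 / 2 / (1 / 4) := by field_simp
  have h2 : (r / 4)⁻¹ = (1 / 4)⁻¹ * r⁻¹ := by field_simp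
  rw [h1, h2]

theorem mollifier_eq_scale {r : ℝ} (hr : 0 < r) (y : Eucl n) :
    mollifier n hr y = (r ^ n)⁻¹ * mollifier n one_pos (r⁻¹ • y) := by
  have hint : ∫ y, bump n hr y = r ^ n * ∫ y, bump n one_pos y := by
    simp only [bump_apply_eq_scale hr]
    rw [Measure.integral_comp_inv_smul_of_nonneg _ (fun y => bump n one_pos y) hr.le]
    simp
  rw [mollifier, mollifier, ContDiffBump.normed_def, ContDiffBump.normed_def, hint,
    bump_apply_eq_scale hr]
  field_simp

/-- The scaling of the derivatives of the mollifier, with a constant independent of the scale. -/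
theorem exists_norm_iteratedFDeriv_mollifier_le (n k : ℕ) : ∃ A : ℝ, 0 < A ∧
    ∀ (r : ℝ) (hr : 0 < r) (y : Eucl n),
      ‖iteratedFDeriv ℝ k (mollifier n hr) y‖ ≤ A * (r ^ n)⁻¹ * (r ^ k)⁻¹ := by
  obtain ⟨A, hA⟩ := ((hasCompactSupport_mollifier (n := n) one_pos).iteratedFDeriv
    (𝕜 := ℝ) k).exists_bound_of_continuous
    ((contDiff_mollifier one_pos).continuous_iteratedFDeriv (by exact_mod_cast le_top))
  refine ⟨max A 1, by positivity, fun r hr y => ?_⟩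
  have h1 : mollifier n hr = (r ^ n)⁻¹ • fun y => mollifier n one_pos (r⁻¹ • y) := by
    funext y; simp [mollifier_eq_scale hr y]
  have hc : ContDiff ℝ k (mollifier n one_pos) :=
    (contDiff_mollifier one_pos).of_le (by exact_mod_cast le_top)
  rw [h1, iteratedFDeriv_const_smul_apply (f := fun y => mollifier n one_pos (r⁻¹ • y))
    (hc.comp (contDiff_const_smul _)).contDiffAt, iteratedFDeriv_comp_const_smul _ hc,
    norm_smul, norm_smul, norm_pow, norm_inv, norm_inv, norm_pow,
    Real.norm_of_nonneg hr.le, inv_pow, ← mul_assoc, mul_comm _ ‖_‖, ← mul_assoc]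
  gcongr
  exact (hA _).trans (le_max_left _ _)

end Mollifiers

/-! ### The weak derivative is dominated by the mean quotient -/

section Mollification

open Metric Filter Topology

variable {n : ℕ}

/-- The mollifier at scale `1 / (i + 1)`. -/
noncomputable def mollifierSeq (n i : ℕ) : Eucl n → ℝ :=
  mollifier n (r := 1 / ((i : ℝ) + 1)) (by positivity)

theorem ae_tendsto_mollifierSeq_convolution {V : Type*} [NormedAddCommGroup V] [NormedSpace ℝ V]
    [CompleteSpace V] {g : Eucl n → V} (hg : LocallyIntegrable g volume) :
    ∀ᵐ x, Tendsto (fun i : ℕ =>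
      convolution (mollifierSeq n i) g (ContinuousLinearMap.lsmul ℝ ℝ) volume x)
      atTop (𝓝 (g x)) := by
  refine ContDiffBump.ae_convolution_tendsto_right_of_locallyIntegrable (K := 2)
    (φ := fun i : ℕ => bump n (r := 1 / ((i : ℝ) + 1)) (by positivity)) ?_ ?_ hg
  · have h := (tendsto_one_div_add_atTop_nhds_zero_nat (𝕜 := ℝ)).div_const 2
    rw [zero_div] at h
    exact h
  · refine Eventually.of_forall fun i => ?_
    simp only [bump]
    linarith

theorem tendsto_mollifierSeq_convolution_of_continuous {g : Eucl n → ℝ} (hg : Continuous g)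
    (x : Eucl n) : Tendsto (fun i : ℕ =>
      convolution (mollifierSeq n i) g (ContinuousLinearMap.lsmul ℝ ℝ) volume x)
      atTop (𝓝 (g x)) := by
  refine ContDiffBump.convolution_tendsto_right_of_continuous
    (φ := fun i : ℕ => bump n (r := 1 / ((i : ℝ) + 1)) (by positivity)) ?_ hg x
  have h := (tendsto_one_div_add_atTop_nhds_zero_nat (𝕜 := ℝ)).div_const 2
  rw [zero_div] at h
  exact h

theorem hasCompactSupport_comp_const_sub {V : Type*} [Zero V] {φ : Eucl n → V}
    (hφ : HasCompactSupport φ) (x : Eucl n) : HasCompactSupport fun z => φ (x - z) :=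
  hφ.comp_homeomorph (Homeomorph.subLeft x)

theorem integrable_mul_of_locallyIntegrable {f φ : Eucl n → ℝ}
    (hf : LocallyIntegrable f volume) (hφ : Continuous φ) (hφc : HasCompactSupport φ) :
    Integrable (fun z => f z * φ z) volume := by
  have := hf.integrable_smul_left_of_hasCompactSupport hφ hφc
  simpa only [smul_eq_mul, mul_comm (φ _)] using this

/-- The `k`-th derivative of the mollification of `f` is the mollification of the `k`-th weak
derivative. -/
theorem HasWeakDeriv.integral_mul_iteratedFDeriv_mollifier {k : ℕ} {f : Eucl n → ℝ}
    {g : Eucl n → ContinuousMultilinearMap ℝ (fun _ : Fin k => Eucl n) ℝ}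
    (h : HasWeakDeriv k f g) {r : ℝ} (hr : 0 < r) (x : Eucl n) (v : Fin k → Eucl n) :
    ∫ z, f z * iteratedFDeriv ℝ k (mollifier n hr) (x - z) v
      = convolution (mollifier n hr) g (ContinuousLinearMap.lsmul ℝ ℝ) volume x v := by
  have hη := contDiff_mollifier (n := n) hr
  have hηc := hasCompactSupport_mollifier (n := n) hr
  have hc : ContDiff ℝ ∞ fun z => mollifier n hr (x - z) :=
    hη.comp (contDiff_const.sub contDiff_id)
  have hcs := hasCompactSupport_comp_const_sub hηc x
  have h1 := h.integral_eq _ hc hcs v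
  simp only [iteratedFDeriv_comp_const_sub hη, mul_left_comm (f _)] at h1
  rw [integral_const_mul] at h1
  rw [mul_left_cancel₀ (pow_ne_zero k (by norm_num : (-1 : ℝ) ≠ 0)) h1, convolution_lsmul_swap]
  have hint : Integrable fun t => mollifier n hr (x - t) • g t :=
    h.locallyIntegrable_deriv.integrable_smul_left_of_hasCompactSupport hc.continuous hcs
  exact ((ContinuousMultilinearMap.apply ℝ (fun _ : Fin k => Eucl n) ℝ v).integral_comp_comm hint)

theorem IsWeakJet.locallyIntegrable_zero {k : ℕ} {f : Eucl n → ℝ}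
    {F : Eucl n → FormalMultilinearSeries ℝ (Eucl n) ℝ} (h : IsWeakJet k f F) :
    LocallyIntegrable (fun y => F y 0 0) volume := by
  have : (fun y => F y 0 0) = f := funext h.1
  rw [this]
  exact (h.2 0 (Nat.zero_le k)).locallyIntegrable

/-- Derivatives of order `k + 1` do not see the Taylor polynomial of order `k`. -/
theorem integral_mul_iteratedFDeriv_mollifier_eq_taylorRemainder {k : ℕ}
    {F : Eucl n → FormalMultilinearSeries ℝ (Eucl n) ℝ}
    (hF : LocallyIntegrable (fun y => F y 0 0) volume) {r : ℝ} (hr : 0 < r) (x : Eucl n)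
    (v : Fin (k + 1) → Eucl n) :
    ∫ z, F z 0 0 * iteratedFDeriv ℝ (k + 1) (mollifier n hr) (x - z) v
      = ∫ z, taylorRemainder k F z x
          * iteratedFDeriv ℝ (k + 1) (mollifier n hr) (x - z) v := by
  have hη := contDiff_mollifier (n := n) hr
  have hηc := hasCompactSupport_mollifier (n := n) hr
  have hc : ContDiff ℝ ∞ fun z => mollifier n hr (x - z) :=
    hη.comp (contDiff_const.sub contDiff_id)
  have hcs := hasCompactSupport_comp_const_sub hηc x
  have hD : Continuous fun z => iteratedFDeriv ℝ (k + 1) (mollifier n hr) (x - z) v :=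
    (contDiff_iteratedFDeriv_apply hη (k + 1) v).continuous.comp
      (continuous_const.sub continuous_id)
  have hDc := hasCompactSupport_comp_const_sub
    (hasCompactSupport_iteratedFDeriv_apply hηc (k + 1) v) x
  have hT := contDiff_taylorField k F x
  have hzero : ∫ z, taylorField k F z x
      * iteratedFDeriv ℝ (k + 1) (mollifier n hr) (x - z) v = 0 := by
    have h1 := integral_mul_iteratedFDeriv_apply volume hT hc hcs (k + 1) v
    simp only [iteratedFDeriv_taylorField_eq_zero, iteratedFDeriv_comp_const_sub hη,
      zero_apply, mul_zero, integral_zero,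
      mul_left_comm (taylorField k F _ x)] at h1
    rw [integral_const_mul] at h1
    exact (mul_eq_zero.1 h1).resolve_left (pow_ne_zero _ (by norm_num))
  simp only [taylorRemainder, sub_mul]
  rw [integral_sub (integrable_mul_of_locallyIntegrable hF hD hDc)
    (integrable_mul_of_locallyIntegrable hT.continuous.locallyIntegrable hD hDc), hzero, sub_zero]

theorem enorm_taylorRemainder_le_mul_div (k m : ℕ)
    (F : Eucl n → FormalMultilinearSeries ℝ (Eucl n) ℝ) {x z : Eucl n} {r : ℝ}
    (hz : ‖z - x‖ ≤ r) :
    ‖taylorRemainder k F z x‖ₑ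
      ≤ ENNReal.ofReal r ^ m * (‖taylorRemainder k F z x‖ₑ / ‖z - x‖ₑ ^ m) := by
  rcases eq_or_ne z x with rfl | hne
  · simp [taylorRemainder_self]
  have h0 : ‖z - x‖ₑ ≠ 0 := by simpa [sub_eq_zero] using hne
  calc ‖taylorRemainder k F z x‖ₑ
      = ‖z - x‖ₑ ^ m * (‖taylorRemainder k F z x‖ₑ / ‖z - x‖ₑ ^ m) :=
        (ENNReal.mul_div_cancel (pow_ne_zero _ h0) (ENNReal.pow_ne_top enorm_ne_top)).symm
    _ ≤ _ := by
        gcongr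
        rw [← ofReal_norm]
        exact ENNReal.ofReal_le_ofReal hz

theorem setLIntegral_taylorRemainder_le (k m : ℕ)
    (F : Eucl n → FormalMultilinearSeries ℝ (Eucl n) ℝ) (x : Eucl n) {r : ℝ} (hr : 0 < r) :
    ∫⁻ z in ball x r, ‖taylorRemainder k F z x‖ₑ
      ≤ ENNReal.ofReal r ^ m * volume (ball x r)
        * ⨍⁻ z in ball x r, ‖taylorRemainder k F z x‖ₑ / ‖z - x‖ₑ ^ m ∂volume := by
  calc ∫⁻ z in ball x r, ‖taylorRemainder k F z x‖ₑ
      ≤ ∫⁻ z in ball x r, ENNReal.ofReal r ^ m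
          * (‖taylorRemainder k F z x‖ₑ / ‖z - x‖ₑ ^ m) :=
        setLIntegral_mono' measurableSet_ball fun z hz =>
          enorm_taylorRemainder_le_mul_div k m F (by
            rw [mem_ball, dist_eq_norm] at hz; exact hz.le)
    _ = ENNReal.ofReal r ^ m
          * ∫⁻ z in ball x r, ‖taylorRemainder k F z x‖ₑ / ‖z - x‖ₑ ^ m :=
        lintegral_const_mul' _ _ (by finiteness)
    _ = _ := by
        rw [setLAverage_eq, mul_assoc, ENNReal.mul_div_cancel
          (measure_ball_pos volume x hr).ne' measure_ball_lt_top.ne]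

/-- The derivatives of order `k + 1` of the mollified function are controlled, at *every* point, by
the mean quotients. -/
theorem exists_enorm_integral_mul_iteratedFDeriv_mollifier_le (n k : ℕ) :
    ∃ C : ℝ≥0, 0 < C ∧ ∀ (F : Eucl n → FormalMultilinearSeries ℝ (Eucl n) ℝ),
      LocallyIntegrable (fun y => F y 0 0) volume →
      ∀ (r : ℝ) (hr : 0 < r) (x : Eucl n) (v : Fin (k + 1) → Eucl n),
      ‖∫ z, F z 0 0 * iteratedFDeriv ℝ (k + 1) (mollifier n hr) (x - z) v‖ₑ
        ≤ C * (∏ i, ‖v i‖ₑ)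
          * ⨍⁻ z in ball x r, ‖taylorRemainder k F z x‖ₑ / ‖z - x‖ₑ ^ (k + 1) ∂volume := by
  obtain ⟨A, hA0, hA⟩ := exists_norm_iteratedFDeriv_mollifier_le n (k + 1)
  have hB : volume (ball (0 : Eucl n) 1) ≠ ⊤ := measure_ball_lt_top.ne
  have hB0 : 0 < volume (ball (0 : Eucl n) 1) := measure_ball_pos volume _ one_pos
  refine ⟨A.toNNReal * (volume (ball (0 : Eucl n) 1)).toNNReal,
    mul_pos (Real.toNNReal_pos.2 hA0) (ENNReal.toNNReal_pos hB0.ne' hB), ?_⟩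
  intro F hF r hr x v
  rw [integral_mul_iteratedFDeriv_mollifier_eq_taylorRemainder hF]
  set K : ℝ≥0∞ := ENNReal.ofReal (A * (r ^ n)⁻¹ * (r ^ (k + 1))⁻¹) * ∏ i, ‖v i‖ₑ with hK
  have hKt : K ≠ ⊤ := ENNReal.mul_ne_top ENNReal.ofReal_ne_top
    (ENNReal.prod_ne_top fun i _ => enorm_ne_top)
  have hpt : ∀ z, ‖taylorRemainder k F z x
      * iteratedFDeriv ℝ (k + 1) (mollifier n hr) (x - z) v‖ₑ
      ≤ (ball x r).indicator (fun z => K * ‖taylorRemainder k F z x‖ₑ) z := by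
    intro z
    by_cases hz : z ∈ ball x r
    · rw [Set.indicator_of_mem hz, enorm_mul, mul_comm]
      gcongr
      have h1 : ‖iteratedFDeriv ℝ (k + 1) (mollifier n hr) (x - z) v‖
          ≤ A * (r ^ n)⁻¹ * (r ^ (k + 1))⁻¹ * ∏ i, ‖v i‖ :=
        (ContinuousMultilinearMap.le_opNorm _ v).trans (by gcongr; exact hA r hr _)
      rw [← ofReal_norm]
      refine (ENNReal.ofReal_le_ofReal h1).trans ?_
      rw [ENNReal.ofReal_mul (by positivity),
        ENNReal.ofReal_prod_of_nonneg fun i _ => norm_nonneg _]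
      simp only [ofReal_norm, hK, le_refl]
    · rw [Set.indicator_of_notMem hz, iteratedFDeriv_mollifier_eq_zero hr]
      · simp
      · rw [mem_ball, dist_comm, dist_eq_norm] at hz
        exact not_lt.1 hz
  calc _ ≤ ∫⁻ z, ‖taylorRemainder k F z x
            * iteratedFDeriv ℝ (k + 1) (mollifier n hr) (x - z) v‖ₑ :=
        enorm_integral_le_lintegral_enorm _
    _ ≤ ∫⁻ z, (ball x r).indicator (fun z => K * ‖taylorRemainder k F z x‖ₑ) z :=
        lintegral_mono hpt
    _ = K * ∫⁻ z in ball x r, ‖taylorRemainder k F z x‖ₑ := by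
        rw [lintegral_indicator measurableSet_ball, lintegral_const_mul' _ _ hKt]
    _ ≤ K * (ENNReal.ofReal r ^ (k + 1) * volume (ball x r)
          * ⨍⁻ z in ball x r, ‖taylorRemainder k F z x‖ₑ / ‖z - x‖ₑ ^ (k + 1) ∂volume) := by
        gcongr; exact setLIntegral_taylorRemainder_le k (k + 1) F x hr
    _ = (ENNReal.ofReal (A * (r ^ n)⁻¹ * (r ^ (k + 1))⁻¹) * ENNReal.ofReal r ^ (k + 1)
          * ENNReal.ofReal (r ^ n)) * volume (ball (0 : Eucl n) 1) * (∏ i, ‖v i‖ₑ)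
          * ⨍⁻ z in ball x r, ‖taylorRemainder k F z x‖ₑ / ‖z - x‖ₑ ^ (k + 1) ∂volume := by
        rw [Measure.addHaar_ball_of_pos volume x hr, finrank_euclideanSpace_fin, hK]
        ring
    _ = _ := by
        congr 2
        rw [← ENNReal.ofReal_pow hr.le, ← ENNReal.ofReal_mul (by positivity),
          ← ENNReal.ofReal_mul (by positivity), ENNReal.coe_mul, ENNReal.coe_toNNReal hB]
        congr 1
        rw [ENNReal.ofReal]
        congr 2
        field_simp

theorem setLAverage_le_restrictedMeanQuotient (m : ℕ) {R r : ℝ}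
    (F : Eucl n → FormalMultilinearSeries ℝ (Eucl n) ℝ) (x : Eucl n) (hr : 0 < r) (hrR : r ≤ R) :
    ⨍⁻ z in ball x r, ‖taylorRemainder (m - 1) F z x‖ₑ / ‖z - x‖ₑ ^ m ∂volume
      ≤ restrictedMeanQuotient m R F x :=
  le_iSup_of_le r (le_iSup_of_le hr (le_iSup_of_le hrR le_rfl))

/-- A weak derivative of order `k + 1` is dominated by the restricted mean quotient, of any radius,
almost everywhere. -/
theorem exists_enorm_weakDeriv_le_restrictedMeanQuotient (n k : ℕ) :
    ∃ C : ℝ≥0, 0 < C ∧ ∀ (f : Eucl n → ℝ) (F : Eucl n → FormalMultilinearSeries ℝ (Eucl n) ℝ)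
      (G : Eucl n → ContinuousMultilinearMap ℝ (fun _ : Fin (k + 1) => Eucl n) ℝ),
      IsWeakJet k f F → HasWeakDeriv (k + 1) f G → ∀ R : ℝ, 0 < R →
      ∀ᵐ x, ‖G x‖ₑ ≤ C * restrictedMeanQuotient (k + 1) R F x := by
  obtain ⟨C, hC0, hC⟩ := exists_enorm_integral_mul_iteratedFDeriv_mollifier_le n k
  refine ⟨C, hC0, fun f F G hF hG R hR => ?_⟩
  filter_upwards [ae_tendsto_mollifierSeq_convolution hG.locallyIntegrable_deriv] with x hx
  rcases eq_or_ne (restrictedMeanQuotient (k + 1) R F x) ⊤ with htop | htop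
  · rw [htop, ENNReal.mul_top (by exact_mod_cast hC0.ne')]
    exact le_top
  have hN : (C : ℝ≥0∞) * restrictedMeanQuotient (k + 1) R F x ≠ ⊤ :=
    ENNReal.mul_ne_top ENNReal.coe_ne_top htop
  refine le_of_tendsto hx.enorm ?_
  filter_upwards [(tendsto_one_div_add_atTop_nhds_zero_nat (𝕜 := ℝ)).eventually_le_const hR]
    with i hi
  rw [← ofReal_norm, ENNReal.ofReal_le_iff_le_toReal hN]
  refine ContinuousMultilinearMap.opNorm_le_bound (by positivity) fun v => ?_
  have hpos : 0 < 1 / ((i : ℝ) + 1) := by positivity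
  have h1 := hC F hF.locallyIntegrable_zero _ hpos x v
  simp only [hF.1] at h1
  rw [hG.integral_mul_iteratedFDeriv_mollifier hpos] at h1
  have h2 := h1.trans (mul_le_mul_right
    (setLAverage_le_restrictedMeanQuotient (k + 1) F x hpos hi) _)
  have h3 := ENNReal.toReal_mono (by
    rw [mul_right_comm]
    exact ENNReal.mul_ne_top hN (ENNReal.prod_ne_top fun i _ => enorm_ne_top)) h2
  rw [mul_right_comm, ENNReal.toReal_mul, ENNReal.toReal_prod] at h3
  simp only [toReal_enorm] at h3
  exact h3

end Mollification

/-! ### Averages over balls and homotheties -/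

section Averages

open Metric

variable {E : Type*} [NormedAddCommGroup E] [NormedSpace ℝ E] [FiniteDimensional ℝ E]
  [MeasurableSpace E] [BorelSpace E] (μ : Measure E) [μ.IsAddHaarMeasure]

theorem map_add_smul_addHaar (a : E) {t : ℝ} (ht : 0 < t) :
    μ.map (fun z => a + t • z) = ENNReal.ofReal (|(t ^ Module.finrank ℝ E)⁻¹|) • μ := by
  have h1 : (fun z : E => a + t • z) = (fun z => a + z) ∘ fun z => t • z := rfl
  rw [h1, ← Measure.map_map (measurable_const_add a) (measurable_const_smul t),
    Measure.map_addHaar_smul μ ht.ne', Measure.map_smul, map_add_left_eq_self]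

theorem quasiMeasurePreserving_add_smul (a : E) {t : ℝ} (ht : 0 < t) :
    Measure.QuasiMeasurePreserving (fun z => a + t • z) μ μ := by
  refine ⟨by fun_prop, ?_⟩
  rw [map_add_smul_addHaar μ a ht]
  exact Measure.smul_absolutelyContinuous

/-- Averages over balls are transported by homotheties. -/
theorem setLAverage_ball_comp_add_smul (H : E → ℝ≥0∞) (a c : E) {t : ℝ} (ht : 0 < t) (r : ℝ) :
    ⨍⁻ z in ball c r, H (a + t • z) ∂μ = ⨍⁻ y in ball (a + t • c) (t * r), H y ∂μ := by
  let e : E ≃ₜ E := (Homeomorph.smulOfNeZero t ht.ne').trans (Homeomorph.addLeft a)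
  have he : ∀ z, e z = a + t • z := fun z => rfl
  have hpre : e ⁻¹' ball (a + t • c) (t * r) = ball c r := by
    ext z
    rw [Set.mem_preimage, he, mem_ball, mem_ball, dist_add_left, dist_smul₀,
      Real.norm_of_nonneg ht.le, mul_lt_mul_iff_right₀ ht]
  have hmap : μ.map e = ENNReal.ofReal (|(t ^ Module.finrank ℝ E)⁻¹|) • μ :=
    map_add_smul_addHaar μ a ht
  have hint : ∫⁻ z in ball c r, H (a + t • z) ∂μ
      = ENNReal.ofReal (|(t ^ Module.finrank ℝ E)⁻¹|)
        * ∫⁻ y in ball (a + t • c) (t * r), H y ∂μ := by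
    have h2 := (e.toMeasurableEquiv.restrict_map μ (ball (a + t • c) (t * r)))
    have h3 := lintegral_map_equiv (μ := μ.restrict (ball c r)) H e.toMeasurableEquiv
    simp only [Homeomorph.toMeasurableEquiv_coe, he] at h3 h2
    rw [← h3]
    rw [hpre] at h2
    rw [← h2, hmap, Measure.restrict_smul, lintegral_smul_measure, smul_eq_mul]
  have hvol : μ (ball c r) = ENNReal.ofReal (|(t ^ Module.finrank ℝ E)⁻¹|)
      * μ (ball (a + t • c) (t * r)) := by
    have h4 := congrArg (fun ν : Measure E => ν (ball (a + t • c) (t * r))) hmap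
    simp only [Measure.smul_apply, smul_eq_mul] at h4
    rw [← h4, Measure.map_apply e.continuous.measurable measurableSet_ball, hpre]
  rw [setLAverage_eq, setLAverage_eq, hint, hvol]
  have hpos : 0 < |(t ^ Module.finrank ℝ E)⁻¹| := by positivity
  exact ENNReal.mul_div_mul_left _ _ (by simpa using hpos) ENNReal.ofReal_ne_top

end Averages

/-! ### A one-dimensional Taylor estimate -/

section Taylor

/-- Taylor's theorem on `[0, 1]`, in the form of a bound by the integral of the top derivative. -/
theorem enorm_sub_taylor_le_lintegral {q : ℕ → ℝ → ℝ}
    (hq : ∀ j t, HasDerivAt (q j) (q (j + 1) t) t) (k : ℕ) :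
    ‖q 0 1 - ∑ j ∈ Finset.range (k + 1), q j 0 / (j.factorial : ℝ)‖ₑ
      ≤ ∫⁻ t in Set.Ioc (0 : ℝ) 1, ‖q (k + 1) t‖ₑ := by
  have hderiv : ∀ k t, HasDerivAt
      (fun t => ∑ j ∈ Finset.range (k + 1), q j t * ((1 - t) ^ j / (j.factorial : ℝ)))
      (q (k + 1) t * ((1 - t) ^ k / (k.factorial : ℝ))) t := by
    intro k t
    induction k with
    | zero => simpa using hq 0 t
    | succ k ih =>
      have h1 : HasDerivAt (fun t : ℝ => (1 - t) ^ (k + 1) / ((k + 1).factorial : ℝ))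
          (-((1 - t) ^ k / (k.factorial : ℝ))) t := by
        have h2 := ((((hasDerivAt_id t).const_sub 1).pow (k + 1)).div_const
          ((k + 1).factorial : ℝ))
        refine h2.congr_deriv ?_
        have : (k.factorial : ℝ) ≠ 0 := by positivity
        rw [Nat.factorial_succ]
        push_cast
        simp only [id]
        field_simp
      have h3 := ih.add ((hq (k + 1) t).mul h1)
      simp only [Finset.sum_range_succ _ (k + 1)]
      refine h3.congr_deriv ?_
      ring
  have hcont : ∀ j, Continuous (q j) := fun j =>
    continuous_iff_continuousAt.2 fun t => (hq j t).continuousAt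
  have hftc := intervalIntegral.integral_eq_sub_of_hasDerivAt (a := 0) (b := 1)
    (fun t _ => hderiv k t)
    (((hcont (k + 1)).mul (by fun_prop)).intervalIntegrable 0 1)
  have hone : ∑ j ∈ Finset.range (k + 1), q j 1 * ((1 - 1) ^ j / (j.factorial : ℝ)) = q 0 1 := by
    rw [Finset.sum_eq_single 0]
    · simp
    · intro j _ hj; simp [hj]
    · simp
  have hzero : ∑ j ∈ Finset.range (k + 1), q j 0 * ((1 - 0) ^ j / (j.factorial : ℝ))
      = ∑ j ∈ Finset.range (k + 1), q j 0 / (j.factorial : ℝ) :=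
    Finset.sum_congr rfl fun j _ => by simp [div_eq_mul_inv]
  rw [hone, hzero] at hftc
  rw [← hftc, intervalIntegral.integral_of_le zero_le_one]
  refine (enorm_integral_le_lintegral_enorm _).trans
    (setLIntegral_mono' measurableSet_Ioc fun t ht => ?_)
  rw [enorm_mul]
  refine mul_le_of_le_one_right' ?_
  have hle : (1 - t) ^ k / (k.factorial : ℝ) ≤ 1 := by
    rw [div_le_one (by positivity)]
    exact (pow_le_one₀ (by linarith [ht.2]) (by linarith [ht.1])).trans
      (by exact_mod_cast Nat.one_le_iff_ne_zero.2 k.factorial_ne_zero)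
  rw [← ofReal_norm, Real.norm_of_nonneg (div_nonneg (pow_nonneg (by linarith [ht.2]) _)
    (by positivity))]
  exact ENNReal.ofReal_le_one.2 hle

end Taylor

/-! ### The mean quotient is dominated by the maximal function of the derivative -/

section UpperBound

open Metric Filter Topology

variable {n : ℕ}

theorem hasDerivAt_integral_mul_iteratedFDeriv {f φ : Eucl n → ℝ}
    (hf : LocallyIntegrable f volume) (hφ : ContDiff ℝ ∞ φ) (hφc : HasCompactSupport φ) (j : ℕ)
    (x w : Eucl n) (t : ℝ) :
    HasDerivAt (fun t : ℝ => ∫ y, f y * iteratedFDeriv ℝ j φ (x + t • w - y) fun _ => w)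
      (∫ y, f y * iteratedFDeriv ℝ (j + 1) φ (x + t • w - y) fun _ => w) t := by
  have hψ := contDiff_iteratedFDeriv_apply hφ j fun _ => w
  have hψc := hasCompactSupport_iteratedFDeriv_apply hφc j fun _ => w
  have h1 := hψc.hasFDerivAt_convolution_right (ContinuousLinearMap.mul ℝ ℝ) hf
    (hψ.of_le (by exact_mod_cast le_top)) (x + t • w)
  have hline : HasDerivAt (fun t : ℝ => x + t • w) w t := by
    simpa using ((hasDerivAt_id t).smul_const w).const_add x
  have h2 := h1.comp_hasDerivAt t hline
  rw [convolution_precompR_apply _ hf (hψc.fderiv ℝ)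
    (hψ.continuous_fderiv (by simp))] at h2
  have h3 : (fun a => fderiv ℝ (fun y => iteratedFDeriv ℝ j φ y fun _ => w) a w)
      = fun a => iteratedFDeriv ℝ (j + 1) φ a fun _ => w := by
    funext a
    exact fderiv_iteratedFDeriv_apply_init hφ j a fun _ => w
  rw [h3] at h2
  exact h2

/-- The Taylor–Whitney remainder of the `k`-jet of the mollification of `f`, at scale `r`. -/
noncomputable def mollifiedRemainder (k : ℕ) {r : ℝ} (hr : 0 < r) (f : Eucl n → ℝ)
    (z x : Eucl n) : ℝ :=
  (∫ y, f y * mollifier n hr (z - y))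
    - ∑ j ∈ Finset.range (k + 1),
      (∫ y, f y * iteratedFDeriv ℝ j (mollifier n hr) (x - y) fun _ => z - x) / (j.factorial : ℝ)

theorem enorm_mollifiedRemainder_le (k : ℕ) {r : ℝ} (hr : 0 < r) {f : Eucl n → ℝ}
    {G : Eucl n → ContinuousMultilinearMap ℝ (fun _ : Fin (k + 1) => Eucl n) ℝ}
    (hG : HasWeakDeriv (k + 1) f G) (z x : Eucl n) :
    ‖mollifiedRemainder k hr f z x‖ₑ ≤ ‖z - x‖ₑ ^ (k + 1)
      * ∫⁻ t in Set.Ioc (0 : ℝ) 1,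
        ‖convolution (mollifier n hr) G (ContinuousLinearMap.lsmul ℝ ℝ) volume
          (x + t • (z - x))‖ₑ := by
  have hη := contDiff_mollifier (n := n) hr
  have hηc := hasCompactSupport_mollifier (n := n) hr
  have h1 := enorm_sub_taylor_le_lintegral (q := fun j t =>
    ∫ y, f y * iteratedFDeriv ℝ j (mollifier n hr) (x + t • (z - x) - y) fun _ => z - x)
    (fun j t => hasDerivAt_integral_mul_iteratedFDeriv hG.locallyIntegrable hη hηc j x (z - x) t) k
  simp only [one_smul, zero_smul, add_zero, add_sub_cancel, iteratedFDeriv_zero_apply] at h1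
  refine h1.trans ?_
  rw [← lintegral_const_mul' _ _ (by finiteness)]
  refine lintegral_mono fun t => ?_
  rw [hG.integral_mul_iteratedFDeriv_mollifier hr, mul_comm]
  have h2 := ContinuousMultilinearMap.le_opNorm
    (convolution (mollifier n hr) G (ContinuousLinearMap.lsmul ℝ ℝ) volume (x + t • (z - x)))
    (fun _ => z - x)
  rw [Finset.prod_const, Finset.card_univ, Fintype.card_fin] at h2
  simp only [← ofReal_norm]
  rw [← ENNReal.ofReal_pow (norm_nonneg _), ← ENNReal.ofReal_mul (norm_nonneg _)]
  exact ENNReal.ofReal_le_ofReal h2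

theorem continuous_mollifier_convolution {V : Type*} [NormedAddCommGroup V] [NormedSpace ℝ V]
    {g : Eucl n → V} (hg : LocallyIntegrable g volume) {r : ℝ} (hr : 0 < r) :
    Continuous (convolution (mollifier n hr) g (ContinuousLinearMap.lsmul ℝ ℝ) volume) :=
  (hasCompactSupport_mollifier hr).continuous_convolution_left _
    (contDiff_mollifier hr).continuous hg

theorem enorm_mollifier_convolution_le {V : Type*} [NormedAddCommGroup V] [NormedSpace ℝ V]
    (g : Eucl n → V) {r : ℝ} (hr : 0 < r) (y : Eucl n) :
    ‖convolution (mollifier n hr) g (ContinuousLinearMap.lsmul ℝ ℝ) volume y‖ₑ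
      ≤ ∫⁻ w, ENNReal.ofReal (mollifier n hr w) * ‖g (y - w)‖ₑ := by
  refine (enorm_integral_le_lintegral_enorm _).trans (lintegral_mono fun w => ?_)
  simp only [ContinuousLinearMap.lsmul_apply, enorm_smul]
  rw [← ofReal_norm (mollifier n hr w), Real.norm_of_nonneg (mollifier_nonneg hr w)]

/-- Averages of a mollified function are averages, with respect to the mollifier, of translated
averages. -/
theorem setLAverage_mollifier_convolution_le {V : Type*} [NormedAddCommGroup V]
    [NormedSpace ℝ V] {g : Eucl n → V} (hg : LocallyIntegrable g volume) {r : ℝ} (hr : 0 < r)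
    (x : Eucl n) {s : ℝ} (hs : 0 < s) :
    ⨍⁻ y in ball x s, ‖convolution (mollifier n hr) g (ContinuousLinearMap.lsmul ℝ ℝ)
        volume y‖ₑ ∂volume
      ≤ ∫⁻ w, ENNReal.ofReal (mollifier n hr w)
        * maximalFunction volume (fun y => ‖g y‖ₑ) (x - w) := by
  have hBt : volume (ball x s) ≠ ⊤ := measure_ball_lt_top.ne
  have hB0 : volume (ball x s) ≠ 0 := (measure_ball_pos volume x hs).ne'
  have hmeas : AEMeasurable (Function.uncurry fun y w : Eucl n =>
      ENNReal.ofReal (mollifier n hr w) * ‖g (y - w)‖ₑ)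
      ((volume.restrict (ball x s)).prod volume) := by
    have h1 : AEMeasurable (fun p : Eucl n × Eucl n => ‖g (p.1 - p.2)‖ₑ)
        (volume.prod volume) :=
      (hg.aestronglyMeasurable.enorm.comp_quasiMeasurePreserving
        (quasiMeasurePreserving_sub volume volume))
    have h2 : AEMeasurable (fun p : Eucl n × Eucl n => ENNReal.ofReal (mollifier n hr p.2))
        (volume.prod volume) :=
      (ENNReal.measurable_ofReal.comp
        ((contDiff_mollifier hr).continuous.measurable.comp measurable_snd)).aemeasurable
    refine (h2.mul h1).mono_measure ?_
    exact Measure.prod_mono Measure.restrict_le_self le_rfl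
  calc _ ≤ ⨍⁻ y in ball x s,
        (∫⁻ w, ENNReal.ofReal (mollifier n hr w) * ‖g (y - w)‖ₑ) ∂volume := by
        simp only [setLAverage_eq]
        gcongr
        exact enorm_mollifier_convolution_le g hr _
    _ = ∫⁻ w, ENNReal.ofReal (mollifier n hr w) * ⨍⁻ y in ball x s, ‖g (y - w)‖ₑ ∂volume := by
        rw [setLAverage_eq, lintegral_lintegral_swap hmeas, ENNReal.div_eq_inv_mul,
          ← lintegral_const_mul' _ _ (ENNReal.inv_ne_top.2 hB0)]
        congr 1
        funext w
        rw [lintegral_const_mul' _ _ ENNReal.ofReal_ne_top, setLAverage_eq,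
          ENNReal.div_eq_inv_mul, mul_left_comm]
    _ ≤ _ := by
        gcongr with w
        have h := setLAverage_ball_comp_add_smul volume (fun y => ‖g y‖ₑ) (-w) x one_pos s
        simp only [one_smul, one_mul, neg_add_eq_sub] at h
        rw [h]
        exact setLAverage_ball_le_maximalFunction volume (fun y => ‖g y‖ₑ) (x - w) hs

/-- Taylor's theorem along segments, averaged over a ball: for fixed `t`, the points `x + t • (z -
x)` fill the ball of radius `t * s` around `x`. -/
theorem setLAverage_mollifiedRemainder_le (k : ℕ) {r : ℝ} (hr : 0 < r) {f : Eucl n → ℝ}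
    {G : Eucl n → ContinuousMultilinearMap ℝ (fun _ : Fin (k + 1) => Eucl n) ℝ}
    (hG : HasWeakDeriv (k + 1) f G) (x : Eucl n) {s : ℝ} (hs : 0 < s) :
    ⨍⁻ z in ball x s, ‖mollifiedRemainder k hr f z x‖ₑ / ‖z - x‖ₑ ^ (k + 1) ∂volume
      ≤ ∫⁻ w, ENNReal.ofReal (mollifier n hr w)
        * maximalFunction volume (fun y => ‖G y‖ₑ) (x - w) := by
  set H : Eucl n → ℝ≥0∞ := fun y =>
    ‖convolution (mollifier n hr) G (ContinuousLinearMap.lsmul ℝ ℝ) volume y‖ₑ with hH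
  have hHc : Continuous H :=
    (continuous_mollifier_convolution hG.locallyIntegrable_deriv hr).enorm
  have hB0 : volume (ball x s) ≠ 0 := (measure_ball_pos volume x hs).ne'
  have hmeas : Measurable (Function.uncurry fun (z : Eucl n) (t : ℝ) => H (x + t • (z - x))) := by
    refine hHc.measurable.comp (Continuous.measurable ?_)
    fun_prop
  calc _ ≤ ⨍⁻ z in ball x s, (∫⁻ t in Set.Ioc (0 : ℝ) 1, H (x + t • (z - x))) ∂volume := by
        simp only [setLAverage_eq]
        gcongr with z
        refine ENNReal.div_le_of_le_mul ?_
        rw [mul_comm]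
        exact enorm_mollifiedRemainder_le k hr hG z x
    _ = ∫⁻ t in Set.Ioc (0 : ℝ) 1, ⨍⁻ z in ball x s, H (x + t • (z - x)) ∂volume := by
        rw [setLAverage_eq, lintegral_lintegral_swap hmeas.aemeasurable, ENNReal.div_eq_inv_mul,
          ← lintegral_const_mul' _ _ (ENNReal.inv_ne_top.2 hB0)]
        congr 1
        funext t
        rw [setLAverage_eq, ENNReal.div_eq_inv_mul]
    _ ≤ ∫⁻ t in Set.Ioc (0 : ℝ) 1, ∫⁻ w, ENNReal.ofReal (mollifier n hr w)
        * maximalFunction volume (fun y => ‖G y‖ₑ) (x - w) := by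
        refine setLIntegral_mono' measurableSet_Ioc fun t ht => ?_
        have h1 : (fun z => H (x + t • (z - x))) = fun z => H ((x - t • x) + t • z) := by
          funext z
          congr 1
          rw [smul_sub]; abel
        rw [h1, setLAverage_ball_comp_add_smul volume H _ x ht.1 s, sub_add_cancel]
        exact setLAverage_mollifier_convolution_le hG.locallyIntegrable_deriv hr x
          (mul_pos ht.1 hs)
    _ = _ := by simp

theorem continuous_mollifiedRemainder {k : ℕ} {f : Eucl n → ℝ}
    {F : Eucl n → FormalMultilinearSeries ℝ (Eucl n) ℝ} (hF : IsWeakJet k f F) {r : ℝ}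
    (hr : 0 < r) (x : Eucl n) : Continuous fun z => mollifiedRemainder k hr f z x := by
  have h0 := continuous_mollifier_convolution (hF.2 0 (Nat.zero_le k)).locallyIntegrable hr
  have h1 : convolution (mollifier n hr) f (ContinuousLinearMap.lsmul ℝ ℝ) volume
      = fun z => ∫ y, f y * mollifier n hr (z - y) := by
    funext z
    simp only [convolution_lsmul_swap, smul_eq_mul, mul_comm (f _)]
  rw [h1] at h0
  refine h0.sub (continuous_finsetSum _ fun j hj => Continuous.div_const ?_ _)
  simp only [(hF.2 j (by simpa [Nat.lt_succ_iff] using hj)).integral_mul_iteratedFDeriv_mollifier]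
  exact (ContinuousMultilinearMap.cont _).comp (by fun_prop)

/-- If the maximal function of the top weak derivative is locally integrable, then it dominates the
maximal mean quotient almost everywhere. This is Taylor's theorem for the mollified function,
combined with Fatou's lemma as the mollification parameter vanishes. -/
theorem ae_maximalMeanQuotient_le_maximalFunction (hn : 1 ≤ n) {k : ℕ} {f : Eucl n → ℝ}
    {F : Eucl n → FormalMultilinearSeries ℝ (Eucl n) ℝ}
    {G : Eucl n → ContinuousMultilinearMap ℝ (fun _ : Fin (k + 1) => Eucl n) ℝ}
    (hF : IsWeakJet k f F) (hG : HasWeakDeriv (k + 1) f G)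
    (hfin : ∀ᵐ x, maximalFunction volume (fun y => ‖G y‖ₑ) x ≠ ⊤)
    (hloc : LocallyIntegrable
      (fun x => (maximalFunction volume (fun y => ‖G y‖ₑ) x).toReal) volume) :
    ∀ᵐ x, maximalMeanQuotient (k + 1) F x ≤ maximalFunction volume (fun y => ‖G y‖ₑ) x := by
  have : Nonempty (Fin n) := ⟨⟨0, hn⟩⟩
  set M := maximalFunction volume (fun y => ‖G y‖ₑ) with hM
  have hjet : ∀ᵐ x, ∀ j ∈ Finset.range (k + 1), Tendsto (fun i : ℕ =>
      convolution (mollifierSeq n i) (fun y => F y j) (ContinuousLinearMap.lsmul ℝ ℝ) volume x)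
      atTop (𝓝 (F x j)) := by
    rw [eventually_all_finset]
    intro j hj
    exact ae_tendsto_mollifierSeq_convolution
      (hF.2 j (by simpa [Nat.lt_succ_iff] using hj)).locallyIntegrable_deriv
  have hf := ae_tendsto_mollifierSeq_convolution hG.locallyIntegrable
  filter_upwards [hjet, ae_tendsto_mollifierSeq_convolution hloc, hfin] with x hx hMx hMfin
  have hpos : ∀ i : ℕ, 0 < 1 / ((i : ℝ) + 1) := fun i => by positivity
  -- The mollified remainders converge almost everywhere in the first variable.
  have hrem : ∀ᵐ z, Tendsto (fun i : ℕ =>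
      ‖mollifiedRemainder k (hpos i) f z x‖ₑ / ‖z - x‖ₑ ^ (k + 1)) atTop
      (𝓝 (‖taylorRemainder k F z x‖ₑ / ‖z - x‖ₑ ^ (k + 1))) := by
    have hne : ∀ᵐ z : Eucl n, z ≠ x := by
      rw [ae_iff]; simp
    filter_upwards [hf, hne] with z hz hzx
    refine ENNReal.Tendsto.div_const (Tendsto.enorm ?_) (Or.inr ?_)
    · rw [taylorRemainder, hF.1]
      refine Tendsto.sub ?_ (tendsto_finsetSum _ fun j hj => Tendsto.div_const ?_ _)
      · simp only [convolution_lsmul_swap, smul_eq_mul] at hz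
        simp only [mul_comm (f _)]
        exact hz
      · have hj' : j ≤ k := by simpa [Nat.lt_succ_iff] using hj
        simp only [(hF.2 j hj').integral_mul_iteratedFDeriv_mollifier]
        exact ((ContinuousMultilinearMap.apply ℝ (fun _ : Fin j => Eucl n) ℝ
          fun _ => z - x).continuous.tendsto _).comp (hx j hj)
    · exact pow_ne_zero _ (by simpa [sub_eq_zero] using hzx)
  -- The mollifications of the maximal function converge.
  have hbound : Tendsto (fun i : ℕ => ∫⁻ w, ENNReal.ofReal (mollifier n (hpos i) w) * M (x - w))
      atTop (𝓝 (M x)) := by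
    have h1 := (ENNReal.continuous_ofReal.tendsto _).comp hMx
    rw [ENNReal.ofReal_toReal hMfin] at h1
    refine h1.congr fun i => ?_
    have hη := contDiff_mollifier (n := n) (hpos i)
    have hint : Integrable fun w => mollifier n (hpos i) w * (M (x - w)).toReal :=
      (hasCompactSupport_mollifier (hpos i)).convolutionExists_left
        (ContinuousLinearMap.lsmul ℝ ℝ) hη.continuous hloc x
    rw [Function.comp_apply, convolution]
    simp only [ContinuousLinearMap.lsmul_apply, smul_eq_mul]
    rw [show mollifierSeq n i = mollifier n (hpos i) from rfl,
      ofReal_integral_eq_lintegral_ofReal hint (Eventually.of_forall fun w =>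
      mul_nonneg (mollifier_nonneg _ w) ENNReal.toReal_nonneg)]
    refine lintegral_congr_ae ?_
    have hfin' : ∀ᵐ w, M (x - w) ≠ ⊤ :=
      (quasiMeasurePreserving_sub_left volume x).ae hfin
    filter_upwards [hfin'] with w hw
    rw [ENNReal.ofReal_mul (mollifier_nonneg _ w), ENNReal.ofReal_toReal hw]
  refine iSup₂_le fun R hR => iSup_le fun r => iSup_le fun hr => iSup_le fun _ => ?_
  rw [setLAverage_eq]
  refine ENNReal.div_le_of_le_mul ?_
  have hB0 : volume (ball x r) ≠ 0 := (measure_ball_pos volume x hr).ne'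
  have hBt : volume (ball x r) ≠ ⊤ := measure_ball_lt_top.ne
  have hmeas : ∀ i, Measurable fun z =>
      ‖mollifiedRemainder k (hpos i) f z x‖ₑ / ‖z - x‖ₑ ^ (k + 1) := fun i =>
    (continuous_mollifiedRemainder hF (hpos i) x).measurable.enorm.div
      ((measurable_id.sub_const x).enorm.pow_const _)
  calc ∫⁻ z in ball x r, ‖taylorRemainder k F z x‖ₑ / ‖z - x‖ₑ ^ (k + 1)
      = ∫⁻ z in ball x r, liminf (fun i : ℕ =>
          ‖mollifiedRemainder k (hpos i) f z x‖ₑ / ‖z - x‖ₑ ^ (k + 1)) atTop :=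
        lintegral_congr_ae (ae_restrict_of_ae (hrem.mono fun z hz => hz.liminf_eq.symm))
    _ ≤ liminf (fun i : ℕ => ∫⁻ z in ball x r,
          ‖mollifiedRemainder k (hpos i) f z x‖ₑ / ‖z - x‖ₑ ^ (k + 1)) atTop :=
        lintegral_liminf_le hmeas
    _ ≤ liminf (fun i : ℕ =>
          (∫⁻ w, ENNReal.ofReal (mollifier n (hpos i) w) * M (x - w)) * volume (ball x r))
          atTop := by
        refine liminf_le_liminf (Eventually.of_forall fun i => ?_)
        have h2 := setLAverage_mollifiedRemainder_le k (hpos i) hG x hr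
        rw [setLAverage_eq] at h2
        exact (ENNReal.div_le_iff hB0 hBt).1 h2
    _ = M x * volume (ball x r) :=
        (ENNReal.Tendsto.mul_const hbound (Or.inr hBt)).liminf_eq

end UpperBound

/-! ### Weak limits of dominated sequences -/

section WeakLimits

open Metric Filter Topology

/-- Weak sequential limits exist in a Hilbert space, in the sense that for a bounded sequence there
is a vector which is the weak limit in all directions in which the sequence converges weakly. -/
theorem exists_inner_eq_of_tendsto_inner {H : Type*} [NormedAddCommGroup H]
    [InnerProductSpace ℝ H] [CompleteSpace H] {u : ℕ → H} {B : ℝ} (hB : ∀ i, ‖u i‖ ≤ B) :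
    ∃ u₀ : H, ∀ (ψ : H) (l : ℝ), Tendsto (fun i => inner ℝ (u i) ψ) atTop (𝓝 l) →
      inner ℝ u₀ ψ = l := by
  let T : ℕ → WeakDual ℝ H := fun i =>
    StrongDual.toWeakDual (InnerProductSpace.toDual ℝ H (u i))
  have hcomp := WeakDual.isCompact_closedBall (𝕜 := ℝ) (E := H) 0 B
  have hle : map T atTop ≤ 𝓟 (WeakDual.toStrongDual ⁻¹' closedBall (0 : StrongDual ℝ H) B) := by
    refine tendsto_principal.2 (Eventually.of_forall fun i => ?_)
    rw [Set.mem_preimage, mem_closedBall_zero_iff]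
    exact ((InnerProductSpace.toDual ℝ H).norm_map (u i)).trans_le (hB i)
  obtain ⟨x, -, hx⟩ := hcomp hle
  refine ⟨(InnerProductSpace.toDual ℝ H).symm (WeakDual.toStrongDual x), fun ψ l hl => ?_⟩
  rw [InnerProductSpace.toDual_symm_apply]
  have hev : Continuous fun y : WeakDual ℝ H => y ψ := WeakDual.eval_continuous ψ
  have h1 : ClusterPt (x ψ) (map (fun y : WeakDual ℝ H => y ψ) (map T atTop)) :=
    hx.map hev.continuousAt tendsto_map
  have h2 : map (fun y : WeakDual ℝ H => y ψ) (map T atTop) ≤ 𝓝 l := hl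
  have h3 : ClusterPt (x ψ) (𝓝 l) := h1.mono h2
  exact (eq_of_nhds_neBot h3)

variable {n : ℕ}

/-- A weight, bounded below on balls, which makes a given locally finite measure finite. -/
theorem exists_weight_lintegral_lt_top (ν : Measure (Eucl n))
    (hν : ∀ j : ℕ, ν (closedBall 0 j) < ⊤) :
    ∃ w : Eucl n → ℝ≥0∞, Measurable w ∧ (∀ x, w x ≠ ⊤) ∧
      (∀ j : ℕ, ∃ c : ℝ, 0 < c ∧ ∀ x ∈ closedBall (0 : Eucl n) j, c ≤ (w x).toReal) ∧
      ∫⁻ x, w x ∂ν < ⊤ := by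
  let c : ℕ → ℝ≥0∞ := fun j => 2⁻¹ ^ j * (1 + ν (closedBall 0 j))⁻¹
  have hpow : ∀ j : ℕ, (2⁻¹ : ℝ≥0∞) ^ j ≠ 0 := fun j => pow_ne_zero _ (by simp)
  have hc0 : ∀ j, c j ≠ 0 := fun j => mul_ne_zero (hpow j)
    (ENNReal.inv_ne_zero.2 (by simp [(hν j).ne]))
  have hcle : ∀ j, c j ≤ 2⁻¹ ^ j := fun j =>
    mul_le_of_le_one_right' (ENNReal.inv_le_one.2 le_self_add)
  let w : Eucl n → ℝ≥0∞ := fun x => ∑' j : ℕ, (closedBall (0 : Eucl n) j).indicator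
    (fun _ => c j) x
  have hwt : ∀ x, w x ≠ ⊤ := fun x => by
    refine ne_top_of_le_ne_top (b := 2) (by simp) ?_
    calc w x ≤ ∑' j : ℕ, (2⁻¹ : ℝ≥0∞) ^ j := ENNReal.tsum_le_tsum fun j =>
          (Set.indicator_le_self _ _ _).trans (hcle j)
      _ = 2 := by
          rw [ENNReal.tsum_geometric, ENNReal.one_sub_inv_two, inv_inv]
  refine ⟨w, ?_, hwt, fun j => ⟨(c j).toReal, ?_, fun x hx => ?_⟩, ?_⟩
  · exact Measurable.tsum fun j => measurable_const.indicator measurableSet_closedBall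
  · exact ENNReal.toReal_pos (hc0 j) (ne_top_of_le_ne_top (by simp) (hcle j))
  · refine ENNReal.toReal_mono (hwt x) ?_
    refine le_trans (le_of_eq ?_) (ENNReal.le_tsum j)
    rw [Set.indicator_of_mem hx]
  · refine lt_of_le_of_lt (b := 2) ?_ (by simp)
    rw [lintegral_tsum fun j => (measurable_const.indicator measurableSet_closedBall).aemeasurable]
    calc _ ≤ ∑' j : ℕ, (2⁻¹ : ℝ≥0∞) ^ j := by
          refine ENNReal.tsum_le_tsum fun j => ?_
          rw [lintegral_indicator_const measurableSet_closedBall, mul_assoc]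
          refine mul_le_of_le_one_right' ?_
          rw [mul_comm]
          calc ν (closedBall 0 j) * (1 + ν (closedBall 0 j))⁻¹
              ≤ (1 + ν (closedBall 0 j)) * (1 + ν (closedBall 0 j))⁻¹ := by
                gcongr; exact le_add_self
            _ ≤ 1 := ENNReal.mul_inv_le_one _
      _ = 2 := by
          rw [ENNReal.tsum_geometric, ENNReal.one_sub_inv_two, inv_inv]

/-- For a sequence dominated by a locally integrable function, one locally integrable function is
the limit against all those test functions against which the sequence converges: this is weak
compactness in the Hilbert space `L²(w N dx)`, applied to the bounded functions `h_i / N`, where the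
weight `w` makes `w N` integrable. -/
theorem exists_integral_mul_eq_of_tendsto {h : ℕ → Eucl n → ℝ} {N : Eucl n → ℝ}
    (hh : ∀ i, AEStronglyMeasurable (h i) volume) (hN : LocallyIntegrable N volume)
    (hN0 : ∀ x, 0 ≤ N x) (hNm : Measurable N) (hdom : ∀ i, ∀ᵐ x, ‖h i x‖ ≤ N x) :
    ∃ g : Eucl n → ℝ, LocallyIntegrable g volume ∧
      ∀ (φ : Eucl n → ℝ) (l : ℝ), Continuous φ → HasCompactSupport φ →
        Tendsto (fun i => ∫ x, φ x * h i x) atTop (𝓝 l) → ∫ x, φ x * g x = l := by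
  have hNm' : Measurable fun x => ENNReal.ofReal (N x) := hNm.ennreal_ofReal
  obtain ⟨w, hwm, hwt, hwc, hwint⟩ := exists_weight_lintegral_lt_top
    (volume.withDensity fun x => ENNReal.ofReal (N x)) (fun j => by
      rw [withDensity_apply _ measurableSet_closedBall]
      have := (hN.integrableOn_isCompact (isCompact_closedBall (0 : Eucl n) j)).lintegral_lt_top
      exact this)
  have hwpos : ∀ x, 0 < (w x).toReal := fun x => by
    obtain ⟨j, hj⟩ := exists_nat_ge ‖x‖
    obtain ⟨c, hc, hcw⟩ := hwc j
    exact hc.trans_le (hcw x (by simpa using hj))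
  set D : Eucl n → ℝ≥0∞ := fun x => ENNReal.ofReal (N x) * w x with hD
  have hDm : Measurable D := hNm'.mul hwm
  have hDt : ∀ x, D x < ⊤ := fun x => ENNReal.mul_lt_top ENNReal.ofReal_lt_top (hwt x).lt_top
  have hDr : ∀ x, (D x).toReal = N x * (w x).toReal := fun x => by
    rw [hD, ENNReal.toReal_mul, ENNReal.toReal_ofReal (hN0 x)]
  set μ : Measure (Eucl n) := volume.withDensity D with hμ
  have hfin : IsFiniteMeasure μ := by
    refine ⟨?_⟩
    rw [hμ, withDensity_apply _ MeasurableSet.univ, Measure.restrict_univ]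
    rw [lintegral_withDensity_eq_lintegral_mul _ hNm' hwm] at hwint
    exact hwint
  have hac : μ ≪ volume := withDensity_absolutelyContinuous _ _
  have hintegrable : ∀ a : Eucl n → ℝ,
      Integrable a μ ↔ Integrable (fun x => (D x).toReal • a x) volume := fun a =>
    integrable_withDensity_iff_integrable_smul' hDm (ae_of_all _ hDt)
  have hintegral : ∀ a : Eucl n → ℝ, ∫ x, a x ∂μ = ∫ x, (D x).toReal • a x := fun a =>
    integral_withDensity_eq_integral_toReal_smul hDm (ae_of_all _ hDt) a
  -- The normalized sequence, as a bounded sequence in `L²(μ)`.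
  have ham : ∀ i, AEStronglyMeasurable (fun x => h i x / N x) μ := fun i =>
    ((hh i).mono_ac hac).div₀ hNm.aestronglyMeasurable
  have hab : ∀ i, ∀ᵐ x ∂μ, ‖h i x / N x‖ ≤ 1 := fun i => by
    filter_upwards [hac.ae_le (hdom i)] with x hx
    rw [norm_div, Real.norm_of_nonneg (hN0 x)]
    exact div_le_one_of_le₀ hx (hN0 x)
  have haL : ∀ i, MemLp (fun x => h i x / N x) 2 μ := fun i =>
    MemLp.of_bound (ham i) 1 (hab i)
  obtain ⟨u, hu⟩ := exists_inner_eq_of_tendsto_inner (u := fun i => (haL i).toLp)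
    (fun i => Lp.norm_le_of_ae_bound (zero_le_one) (by
      filter_upwards [(haL i).coeFn_toLp, hab i] with x hx hx'
      rw [hx]; exact hx'))
  refine ⟨fun x => N x * u x, ?_, fun φ l hφ hφc hl => ?_⟩
  · have hint : Integrable u μ := (Lp.memLp u).integrable (by norm_num)
    rw [hintegrable] at hint
    rw [locallyIntegrable_iff]
    intro K hK
    obtain ⟨ρ, hρ⟩ := hK.isBounded.subset_closedBall 0
    obtain ⟨j, hj⟩ := exists_nat_ge ρ
    obtain ⟨c, hc, hcw⟩ := hwc j
    have hrew : (fun x => N x * u x) = fun x => (w x).toReal⁻¹ * ((D x).toReal • u x) := by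
      funext x
      rw [hDr, smul_eq_mul]
      field_simp [(hwpos x).ne']
    refine Integrable.mono' (hint.norm.const_mul c⁻¹).integrableOn ?_ ?_
    · rw [hrew]
      exact ((hwm.ennreal_toReal.inv.aestronglyMeasurable).mul
        hint.aestronglyMeasurable).restrict
    · filter_upwards [ae_restrict_mem hK.measurableSet] with x hx
      rw [show N x * u x = (w x).toReal⁻¹ * ((D x).toReal • u x) from congrFun hrew x, norm_mul,
        norm_inv, Real.norm_of_nonneg ENNReal.toReal_nonneg]
      gcongr
      exact hcw x (closedBall_subset_closedBall hj (hρ hx))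
  · -- Test the weak limit against `φ / w`, which is bounded.
    obtain ⟨ρ, hρ⟩ := hφc.isCompact.isBounded.subset_closedBall 0
    obtain ⟨j, hj⟩ := exists_nat_ge ρ
    obtain ⟨c, hc, hcw⟩ := hwc j
    obtain ⟨A, hA⟩ := hφc.exists_bound_of_continuous hφ
    have hψb : ∀ x, ‖φ x / (w x).toReal‖ ≤ A / c := fun x => by
      by_cases hx : x ∈ tsupport φ
      · rw [norm_div, Real.norm_of_nonneg (hwpos x).le]
        have h1 := hcw x (closedBall_subset_closedBall hj (hρ hx))
        have h2 := hA x
        gcongr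
        exact (norm_nonneg _).trans h2
      · rw [image_eq_zero_of_notMem_tsupport hx]
        have := (norm_nonneg _).trans (hA x)
        simp only [zero_div, norm_zero]
        positivity
    have hψL : MemLp (fun x => φ x / (w x).toReal) 2 μ :=
      MemLp.of_bound ((hφ.measurable.div hwm.ennreal_toReal).aestronglyMeasurable) _
        (ae_of_all _ hψb)
    have hinner : ∀ (a : Lp ℝ 2 μ), inner ℝ a hψL.toLp = ∫ x, φ x * (N x * a x) := by
      intro a
      rw [L2.inner_def]
      have h1 : ∫ x, inner ℝ (a x) ((hψL.toLp : Lp ℝ 2 μ) x) ∂μ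
          = ∫ x, φ x / (w x).toReal * a x ∂μ := by
        refine integral_congr_ae ?_
        filter_upwards [hψL.coeFn_toLp] with x hx
        rw [hx]
        simp
      rw [h1, hintegral]
      congr 1
      funext x
      rw [hDr, smul_eq_mul]
      field_simp [(hwpos x).ne']
    rw [← hinner]
    refine hu _ l (hl.congr fun i => ?_)
    have h1 : ∫ x, inner ℝ (((haL i).toLp : Lp ℝ 2 μ) x) ((hψL.toLp : Lp ℝ 2 μ) x) ∂μ
        = ∫ x, φ x / (w x).toReal * (h i x / N x) ∂μ := by
      refine integral_congr_ae ?_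
      filter_upwards [hψL.coeFn_toLp, (haL i).coeFn_toLp] with x hx hx'
      rw [hx, hx']
      simp
    rw [L2.inner_def, h1, hintegral]
    refine integral_congr_ae ?_
    filter_upwards [hdom i] with x hx
    rw [hDr, smul_eq_mul]
    rcases eq_or_ne (N x) 0 with h0 | h0
    · have : h i x = 0 := by rw [h0] at hx; simpa using hx
      simp [this]
    · field_simp [(hwpos x).ne']

end WeakLimits

/-! ### Existence of weak derivatives -/

section Existence

open Metric Filter Topology

variable {n : ℕ}

theorem continuous_integral_mul_iteratedFDeriv {f φ : Eucl n → ℝ}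
    (hf : LocallyIntegrable f volume) (hφ : ContDiff ℝ ∞ φ) (hφc : HasCompactSupport φ) (k : ℕ)
    (v : Fin k → Eucl n) : Continuous fun x => ∫ z, f z * iteratedFDeriv ℝ k φ (x - z) v :=
  (hasCompactSupport_iteratedFDeriv_apply hφc k v).continuous_convolution_right
    (ContinuousLinearMap.mul ℝ ℝ) hf (contDiff_iteratedFDeriv_apply hφ k v).continuous

/-- Transposition: the derivatives of the mollifier are moved to the test function. -/
theorem integral_mul_integral_mul_iteratedFDeriv_mollifier {f φ : Eucl n → ℝ}
    (hf : LocallyIntegrable f volume) (hφ : ContDiff ℝ ∞ φ) (hφc : HasCompactSupport φ) (k : ℕ)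
    (v : Fin k → Eucl n) {r : ℝ} (hr : 0 < r) :
    ∫ x, φ x * ∫ z, f z * iteratedFDeriv ℝ k (mollifier n hr) (x - z) v
      = (-1) ^ k * ∫ z, f z * convolution (mollifier n hr)
          (fun x => iteratedFDeriv ℝ k φ x v) (ContinuousLinearMap.lsmul ℝ ℝ) volume z := by
  have hη := contDiff_mollifier (n := n) hr
  have hηc := hasCompactSupport_mollifier (n := n) hr
  set ψ : Eucl n → ℝ := fun y => iteratedFDeriv ℝ k (mollifier n hr) y v with hψdef
  have hψ : Continuous ψ := (contDiff_iteratedFDeriv_apply hη k v).continuous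
  have hψc : HasCompactSupport ψ := hasCompactSupport_iteratedFDeriv_apply hηc k v
  obtain ⟨A, hA⟩ := hψc.exists_bound_of_continuous hψ
  -- The integrand vanishes unless `x` and `z` lie in fixed compact sets.
  set K : Set (Eucl n) := (fun p : Eucl n × Eucl n => p.1 - p.2) '' (tsupport φ ×ˢ tsupport ψ)
    with hK
  have hKc : IsCompact K := (hφc.isCompact.prod hψc.isCompact).image (by fun_prop)
  have hint : Integrable (Function.uncurry fun x z => φ x * (f z * ψ (x - z)))
      (volume.prod volume) := by
    have h1 : Integrable (fun p : Eucl n × Eucl n => ‖φ p.1‖ * (‖K.indicator f p.2‖ * A))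
        (volume.prod volume) :=
      (hφ.continuous.integrable_of_hasCompactSupport hφc).norm.mul_prod
        (((hf.integrableOn_isCompact hKc).integrable_indicator hKc.measurableSet).norm.mul_const A)
    refine h1.mono' ?_ (ae_of_all _ fun p => ?_)
    · exact (hφ.continuous.comp continuous_fst).aestronglyMeasurable.mul
        ((hf.aestronglyMeasurable.comp_snd).mul
          (hψ.comp (continuous_fst.sub continuous_snd)).aestronglyMeasurable)
    · obtain ⟨x, z⟩ := p
      simp only [Function.uncurry_apply_pair, norm_mul]
      by_cases hx : x ∈ tsupport φ
      · by_cases hz : x - z ∈ tsupport ψ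
        · have : z ∈ K := ⟨(x, x - z), ⟨hx, hz⟩, by simp⟩
          rw [Set.indicator_of_mem this]
          gcongr
          exact hA _
        · rw [image_eq_zero_of_notMem_tsupport hz]
          have := (norm_nonneg _).trans (hA 0)
          simp only [norm_zero, mul_zero]
          positivity
      · rw [image_eq_zero_of_notMem_tsupport hx]
        simp
  have hswap := integral_integral_swap hint
  simp only [integral_const_mul] at hswap
  rw [hswap, ← integral_const_mul]
  congr 1
  funext z
  simp only [mul_left_comm (φ _)]
  rw [integral_const_mul, mul_left_comm]
  congr 1
  have hshift : ContDiff ℝ ∞ fun x => mollifier n hr (x - z) :=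
    hη.comp (contDiff_id.sub contDiff_const)
  have hshiftc : HasCompactSupport fun x => mollifier n hr (x - z) :=
    hηc.comp_homeomorph (Homeomorph.subRight z)
  have hparts := integral_mul_iteratedFDeriv_apply volume hφ hshift hshiftc k v
  simp only [iteratedFDeriv_comp_sub] at hparts
  rw [hparts, convolution_lsmul_swap]
  congr 2
  funext x
  rw [smul_eq_mul, ← mollifier_neg hr (x - z), neg_sub]

theorem norm_mollifier_convolution_le {g : Eucl n → ℝ} {A : ℝ}
    (hA : ∀ x, ‖g x‖ ≤ A) {r : ℝ} (hr : 0 < r) (x : Eucl n) :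
    ‖convolution (mollifier n hr) g (ContinuousLinearMap.lsmul ℝ ℝ) volume x‖ ≤ A := by
  have h1 : Integrable (mollifier n hr) volume := (bump n hr).integrable_normed
  calc _ ≤ ∫ t, mollifier n hr t * A := by
        refine norm_integral_le_of_norm_le (h1.mul_const A) (ae_of_all _ fun t => ?_)
        rw [ContinuousLinearMap.lsmul_apply, norm_smul,
          Real.norm_of_nonneg (mollifier_nonneg hr t)]
        exact mul_le_mul_of_nonneg_left (hA _) (mollifier_nonneg hr t)
    _ = A := by
        have h2 : ∫ t, mollifier n hr t = 1 := (bump n hr).integral_normed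
        rw [integral_mul_const, h2, one_mul]

theorem mollifierSeq_convolution_eq_zero {g : Eucl n → ℝ} (i : ℕ)
    {x : Eucl n} (hx : x ∉ cthickening 1 (tsupport g)) :
    convolution (mollifierSeq n i) g (ContinuousLinearMap.lsmul ℝ ℝ) volume x = 0 := by
  rw [convolution]
  refine integral_eq_zero_of_ae (ae_of_all _ fun t => ?_)
  simp only [ContinuousLinearMap.lsmul_apply, Pi.zero_apply, smul_eq_mul, mul_eq_zero]
  by_contra! hcon
  have hpos : 0 < 1 / ((i : ℝ) + 1) := by positivity
  have h1 : ‖t‖ ≤ 1 := by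
    by_contra! ht
    have h2 : 1 / ((i : ℝ) + 1) ≤ 1 := by
      rw [div_le_one (by positivity)]
      linarith [(Nat.cast_nonneg i : (0 : ℝ) ≤ i)]
    have h3 := iteratedFDeriv_mollifier_eq_zero hpos 0 (h2.trans ht.le)
    have h4 := congrArg (fun B : ContinuousMultilinearMap ℝ (fun _ : Fin 0 => Eucl n) ℝ => B 0) h3
    simp only [iteratedFDeriv_zero_apply] at h4
    exact hcon.1 h4
  refine hx (mem_cthickening_of_dist_le x (x - t) 1 _
    (subset_tsupport _ (Function.mem_support.2 hcon.2)) ?_)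
  simpa [dist_eq_norm] using h1

theorem tendsto_integral_mul_integral_mul_iteratedFDeriv {f φ : Eucl n → ℝ}
    (hf : LocallyIntegrable f volume) (hφ : ContDiff ℝ ∞ φ) (hφc : HasCompactSupport φ) (k : ℕ)
    (v : Fin k → Eucl n) :
    Tendsto (fun i : ℕ => ∫ x, φ x * ∫ z, f z * iteratedFDeriv ℝ k (mollifierSeq n i) (x - z) v)
      atTop (𝓝 ((-1) ^ k * ∫ z, f z * iteratedFDeriv ℝ k φ z v)) := by
  have hpos : ∀ i : ℕ, 0 < 1 / ((i : ℝ) + 1) := fun i => by positivity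
  have h1 : ∀ i : ℕ, ∫ x, φ x * ∫ z, f z * iteratedFDeriv ℝ k (mollifierSeq n i) (x - z) v
      = (-1) ^ k * ∫ z, f z * convolution (mollifierSeq n i)
          (fun x => iteratedFDeriv ℝ k φ x v) (ContinuousLinearMap.lsmul ℝ ℝ) volume z :=
    fun i => integral_mul_integral_mul_iteratedFDeriv_mollifier hf hφ hφc k v (hpos i)
  simp only [h1]
  refine Tendsto.const_mul _ ?_
  set g : Eucl n → ℝ := fun x => iteratedFDeriv ℝ k φ x v with hg
  have hgc : Continuous g := (contDiff_iteratedFDeriv_apply hφ k v).continuous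
  have hgs : HasCompactSupport g := hasCompactSupport_iteratedFDeriv_apply hφc k v
  obtain ⟨A, hA⟩ := hgs.exists_bound_of_continuous hgc
  have hK : IsCompact (cthickening 1 (tsupport g)) := hgs.isCompact.cthickening
  have hbd : Integrable (fun z => ‖(cthickening 1 (tsupport g)).indicator f z‖ * A) :=
    ((hf.integrableOn_isCompact hK).integrable_indicator hK.measurableSet).norm.mul_const A
  refine tendsto_integral_of_dominated_convergence _ (fun i => ?_) hbd (fun i => ?_) ?_
  · exact hf.aestronglyMeasurable.mul (continuous_mollifier_convolution
      hgc.locallyIntegrable (hpos i)).aestronglyMeasurable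
  · refine ae_of_all _ fun z => ?_
    rw [norm_mul]
    by_cases hz : z ∈ cthickening 1 (tsupport g)
    · rw [Set.indicator_of_mem hz]
      gcongr
      exact norm_mollifier_convolution_le hA (hpos i) z
    · rw [mollifierSeq_convolution_eq_zero i hz]
      simp [Set.indicator_of_notMem hz]
  · exact ae_of_all _ fun z => (tendsto_mollifierSeq_convolution_of_continuous hgc z).const_mul _

/-- The multilinear form `v ↦ ∏ₖ (vₖ)_{I k}`. -/
noncomputable def coordForm {m : ℕ} (I : Fin m → Fin n) :
    ContinuousMultilinearMap ℝ (fun _ : Fin m => Eucl n) ℝ :=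
  (ContinuousMultilinearMap.mkPiAlgebra ℝ (Fin m) ℝ).compContinuousLinearMap
    fun k => EuclideanSpace.proj (I k)

theorem coordForm_apply {m : ℕ} (I : Fin m → Fin n) (v : Fin m → Eucl n) :
    coordForm I v = ∏ k, v k (I k) := by
  simp [coordForm]

theorem apply_eq_sum_coordForm {m : ℕ}
    (A : ContinuousMultilinearMap ℝ (fun _ : Fin m => Eucl n) ℝ) (v : Fin m → Eucl n) :
    A v = ∑ I : Fin m → Fin n,
      coordForm I v * A fun k => EuclideanSpace.single (I k) (1 : ℝ) := by
  have hv : v = fun k => ∑ i : Fin n, v k i • EuclideanSpace.single i (1 : ℝ) := by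
    funext k
    ext i
    simp [Finset.sum_apply, Pi.single_apply]
  conv_lhs => rw [hv]
  rw [A.map_sum]
  refine Finset.sum_congr rfl fun I _ => ?_
  rw [A.map_smul_univ, coordForm_apply, smul_eq_mul]

theorem locallyIntegrable_sum_smul_const {ι V : Type*} [NormedAddCommGroup V] [NormedSpace ℝ V]
    (s : Finset ι) {g : ι → Eucl n → ℝ} (hg : ∀ i ∈ s, LocallyIntegrable (g i) volume)
    (c : ι → V) : LocallyIntegrable (fun x => ∑ i ∈ s, g i x • c i) volume := by
  refine locallyIntegrable_finsetSum s fun i hi x => ?_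
  obtain ⟨t, ht, hgt⟩ := hg i hi x
  exact ⟨t, ht, Integrable.smul_const hgt _⟩

/-- If the derivatives of order `k` of the mollifications of `f` are dominated by a locally
integrable function, then `f` has a weak derivative of order `k`. -/
theorem exists_hasWeakDeriv_of_dominated {k : ℕ} {f : Eucl n → ℝ}
    (hf : LocallyIntegrable f volume) {N : Eucl n → ℝ} (hN : LocallyIntegrable N volume)
    (hN0 : ∀ x, 0 ≤ N x) (hNm : Measurable N) (i₀ : ℕ)
    (hdom : ∀ i ≥ i₀, ∀ I : Fin k → Fin n, ∀ᵐ x, ‖∫ z, f z * iteratedFDeriv ℝ k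
      (mollifierSeq n i) (x - z) fun l => EuclideanSpace.single (I l) (1 : ℝ)‖ ≤ N x) :
    ∃ G, HasWeakDeriv k f G := by
  have hpos : ∀ i : ℕ, 0 < 1 / ((i : ℝ) + 1) := fun i => by positivity
  have hex : ∀ I : Fin k → Fin n, ∃ g : Eucl n → ℝ, LocallyIntegrable g volume ∧
      ∀ φ : Eucl n → ℝ, ContDiff ℝ ∞ φ → HasCompactSupport φ →
        ∫ x, φ x * g x = (-1) ^ k * ∫ z, f z * iteratedFDeriv ℝ k φ z
          fun l => EuclideanSpace.single (I l) (1 : ℝ) := by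
    intro I
    obtain ⟨g, hg, hlim⟩ := exists_integral_mul_eq_of_tendsto
      (h := fun i x => ∫ z, f z * iteratedFDeriv ℝ k (mollifierSeq n (i + i₀)) (x - z)
        fun l => EuclideanSpace.single (I l) (1 : ℝ))
      (fun i => (continuous_integral_mul_iteratedFDeriv hf (contDiff_mollifier (hpos (i + i₀)))
        (hasCompactSupport_mollifier (hpos (i + i₀))) k _).aestronglyMeasurable)
      hN hN0 hNm (fun i => hdom _ (Nat.le_add_left _ _) I)
    exact ⟨g, hg, fun φ hφ hφc => hlim φ _ hφ.continuous hφc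
      ((tendsto_add_atTop_iff_nat i₀).2
        (tendsto_integral_mul_integral_mul_iteratedFDeriv hf hφ hφc k _))⟩
  choose g hg hgφ using hex
  refine ⟨fun x => ∑ I, g I x • coordForm I, hf, ?_, fun φ hφ hφc v => ?_⟩
  · exact locallyIntegrable_sum_smul_const Finset.univ (fun I _ => hg I) coordForm
  · have hD : ∀ I : Fin k → Fin n, Integrable fun x => f x * iteratedFDeriv ℝ k φ x
        fun l => EuclideanSpace.single (I l) (1 : ℝ) := fun I =>
      integrable_mul_of_locallyIntegrable hf (contDiff_iteratedFDeriv_apply hφ k _).continuous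
        (hasCompactSupport_iteratedFDeriv_apply hφc k _)
    have hgI : ∀ I : Fin k → Fin n, Integrable fun x => φ x * g I x := fun I => by
      simpa only [mul_comm] using integrable_mul_of_locallyIntegrable (hg I) hφ.continuous hφc
    have h1 : ∫ x, f x * iteratedFDeriv ℝ k φ x v = ∑ I : Fin k → Fin n, coordForm I v
        * ∫ x, f x * iteratedFDeriv ℝ k φ x fun l => EuclideanSpace.single (I l) (1 : ℝ) := by
      simp only [fun x => apply_eq_sum_coordForm (iteratedFDeriv ℝ k φ x) v, Finset.mul_sum,
        mul_left_comm (f _)]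
      rw [integral_finsetSum _ fun I _ => (hD I).const_mul _]
      simp only [integral_const_mul]
    have h2 : ∫ x, φ x * (∑ I, g I x • coordForm I) v
        = ∑ I : Fin k → Fin n, coordForm I v * ∫ x, φ x * g I x := by
      simp only [sum_apply, smul_apply,
        smul_eq_mul, Finset.mul_sum, mul_comm (g _ _), mul_left_comm (φ _)]
      rw [integral_finsetSum _ fun I _ => (hgI I).const_mul _]
      simp only [integral_const_mul]
    rw [h1, h2, Finset.mul_sum]
    refine Finset.sum_congr rfl fun I _ => ?_
    have hsq : (-1 : ℝ) ^ k * (-1) ^ k = 1 := by rw [← mul_pow]; simp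
    rw [hgφ I φ hφ hφc, mul_left_comm (coordForm I v), ← mul_assoc ((-1 : ℝ) ^ k), hsq, one_mul]

end Existence

/-! ### Finite differences of Taylor fields -/

section FiniteDifferences

open Polynomial

/-- The vanishing of the `m`-th finite difference of a polynomial of degree `< m` bounds its value
at `0` by its values at `1, …, m`. -/
theorem enorm_eval_zero_le_sum {P : ℝ[X]} {m : ℕ} (hP : P.natDegree < m) :
    ‖P.eval 0‖ₑ ≤ ∑ i ∈ Finset.range m, (m.choose (i + 1) : ℝ≥0∞) * ‖P.eval ((i : ℝ) + 1)‖ₑ := by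
  have h := congrFun (Polynomial.fwdDiff_iter_eq_zero_of_degree_lt hP) 0
  rw [fwdDiff_iter_eq_sum_shift, Finset.sum_range_succ'] at h
  have habs : ∀ (a b : ℕ) (c : ℝ), ‖((-1 : ℤ) ^ a * b) • c‖ₑ = b * ‖c‖ₑ := by
    intro a b c
    rw [zsmul_eq_mul, enorm_mul]
    push_cast
    rw [enorm_mul, enorm_pow, enorm_neg, enorm_one, one_pow, one_mul, ← ofReal_norm,
      RCLike.norm_natCast, ENNReal.ofReal_natCast]
  have h0 : ‖P.eval 0‖ₑ = ‖((-1 : ℤ) ^ (m - 0) * (m.choose 0 : ℕ)) • P.eval (0 + 0 • 1)‖ₑ := by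
    rw [habs]; simp
  rw [h0, eq_neg_of_add_eq_zero_right h, enorm_neg]
  refine (enorm_sum_le _ _).trans (Finset.sum_le_sum fun i _ => ?_)
  rw [habs]
  simp

theorem exists_polynomial_multilinear_line {E : Type*} [NormedAddCommGroup E] [NormedSpace ℝ E]
    {j : ℕ} (A : ContinuousMultilinearMap ℝ (fun _ : Fin j => E) ℝ) (a h : E) :
    ∃ P : ℝ[X], P.natDegree ≤ j ∧ ∀ t : ℝ, P.eval t = A fun _ => t • h + a := by
  classical
  refine ⟨∑ s : Finset (Fin j), C (A (s.piecewise (fun _ => h) fun _ => a)) * X ^ s.card,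
    ?_, fun t => ?_⟩
  · refine natDegree_sum_le_of_forall_le _ _ fun s _ => (natDegree_C_mul_X_pow_le _ _).trans ?_
    simpa using s.card_le_univ
  · have h1 := A.map_add_univ (fun _ => t • h) (fun _ => a)
    have h2 : ((fun _ => t • h) + fun _ => a : Fin j → E) = fun _ => t • h + a := rfl
    rw [h2] at h1
    rw [h1, eval_finsetSum]
    refine Finset.sum_congr rfl fun s _ => ?_
    have h3 := A.map_piecewise_smul (fun _ => t) (s.piecewise (fun _ => h) fun _ => a) s
    rw [Finset.prod_const, smul_eq_mul] at h3
    rw [eval_mul, eval_C, eval_pow, eval_X, mul_comm, ← h3]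
    congr 1
    funext i
    by_cases hi : i ∈ s <;> simp [Finset.piecewise, hi]

variable {n : ℕ}

theorem exists_polynomial_taylorField_line (k : ℕ)
    (F : Eucl n → FormalMultilinearSeries ℝ (Eucl n) ℝ) (x y h : Eucl n) :
    ∃ P : ℝ[X], P.natDegree ≤ k ∧ ∀ t : ℝ, P.eval t = taylorField k F (y + t • h) x := by
  choose P hPd hP using fun j => exists_polynomial_multilinear_line (F x j) (y - x) h
  refine ⟨∑ j ∈ Finset.range (k + 1), P j * C ((j.factorial : ℝ)⁻¹), ?_, fun t => ?_⟩
  · refine natDegree_sum_le_of_forall_le _ _ fun j hj => (natDegree_mul_C_le _ _).trans ?_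
    exact (hPd j).trans (by simpa [Nat.lt_succ_iff] using hj)
  · rw [eval_finsetSum, taylorField]
    refine Finset.sum_congr rfl fun j _ => ?_
    rw [eval_mul, eval_C, hP, div_eq_mul_inv]
    congr 3
    funext _
    abel

/-- The remainder at `y` of the expansion at `x` in terms of remainders at the points `y + i • h`:
the difference of the Taylor polynomials at `x` and at `y` has vanishing finite differences of order
`k + 1`, and at a point `w` it is the difference of the remainders at `w`. -/
theorem enorm_taylorRemainder_le_sum (k : ℕ)
    (F : Eucl n → FormalMultilinearSeries ℝ (Eucl n) ℝ) (x y h : Eucl n) :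
    ‖taylorRemainder k F y x‖ₑ ≤ ∑ i ∈ Finset.range (k + 1), ((k + 1).choose (i + 1) : ℝ≥0∞)
      * (‖taylorRemainder k F (y + ((i : ℝ) + 1) • h) y‖ₑ
        + ‖taylorRemainder k F (y + ((i : ℝ) + 1) • h) x‖ₑ) := by
  obtain ⟨P, hPd, hP⟩ := exists_polynomial_taylorField_line k F x y h
  obtain ⟨Q, hQd, hQ⟩ := exists_polynomial_taylorField_line k F y y h
  have hPQ : ∀ t : ℝ, (P - Q).eval t
      = taylorRemainder k F (y + t • h) y - taylorRemainder k F (y + t • h) x := by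
    intro t
    rw [eval_sub, hP, hQ, taylorRemainder, taylorRemainder]
    ring
  have h0 := enorm_eval_zero_le_sum (P := P - Q) (m := k + 1)
    (Nat.lt_succ_of_le ((natDegree_sub_le _ _).trans (max_le hPd hQd)))
  simp only [hPQ, zero_smul, add_zero, taylorRemainder_self, zero_sub, enorm_neg] at h0
  refine h0.trans (Finset.sum_le_sum fun i _ => ?_)
  gcongr
  exact enorm_sub_le

end FiniteDifferences

/-! ### The pointwise estimate -/

section PointwiseEstimate

open Metric

variable {n : ℕ}

theorem aemeasurable_enorm_taylorRemainder {k : ℕ}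
    {F : Eucl n → FormalMultilinearSeries ℝ (Eucl n) ℝ}
    (hF : LocallyIntegrable (fun y => F y 0 0) volume) (x : Eucl n) :
    AEMeasurable (fun z => ‖taylorRemainder k F z x‖ₑ) volume :=
  (hF.aestronglyMeasurable.sub
    (contDiff_taylorField k F x).continuous.aestronglyMeasurable).enorm

/-- Averaging over a small ball whose dilates stay inside `B(x, r)`. -/
theorem setLAverage_taylorRemainder_comp_le (k m : ℕ)
    (F : Eucl n → FormalMultilinearSeries ℝ (Eucl n) ℝ) (x y c : Eucl n) {s ρ : ℝ}
    {M : ℕ} (hρ : 0 < ρ) (hs : 1 ≤ s) (hM : 0 < M)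
    (hsub : ball (y + s • c) (s * ρ) ⊆ ball x (M * ρ)) :
    ⨍⁻ h in ball c ρ, ‖taylorRemainder k F (y + s • h) x‖ₑ ∂volume
      ≤ (M : ℝ≥0∞) ^ n * ENNReal.ofReal (M * ρ) ^ m
        * ⨍⁻ z in ball x (M * ρ), ‖taylorRemainder k F z x‖ₑ / ‖z - x‖ₑ ^ m ∂volume := by
  have hM' : (0 : ℝ) < M := by exact_mod_cast hM
  have hs0 : 0 < s := by linarith
  rw [setLAverage_ball_comp_add_smul volume (fun z => ‖taylorRemainder k F z x‖ₑ) y c hs0 ρ,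
    setLAverage_eq]
  set A := ⨍⁻ z in ball x (M * ρ), ‖taylorRemainder k F z x‖ₑ / ‖z - x‖ₑ ^ m ∂volume
  refine ENNReal.div_le_of_le_mul ?_
  have hvol : volume (ball x (M * ρ)) ≤ (M : ℝ≥0∞) ^ n * volume (ball (y + s • c) (s * ρ)) := by
    rw [Measure.addHaar_ball_mul_of_pos volume x hM', finrank_euclideanSpace_fin,
      ENNReal.ofReal_pow hM'.le, ENNReal.ofReal_natCast,
      ← Measure.addHaar_ball_center volume (y + s • c) ρ]
    gcongr
    nlinarith
  calc ∫⁻ z in ball (y + s • c) (s * ρ), ‖taylorRemainder k F z x‖ₑ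
      ≤ ∫⁻ z in ball x (M * ρ), ‖taylorRemainder k F z x‖ₑ := lintegral_mono_set hsub
    _ ≤ ENNReal.ofReal (M * ρ) ^ m * volume (ball x (M * ρ)) * A :=
        setLIntegral_taylorRemainder_le k m F x (by positivity)
    _ ≤ ENNReal.ofReal (M * ρ) ^ m
          * ((M : ℝ≥0∞) ^ n * volume (ball (y + s • c) (s * ρ))) * A := by gcongr
    _ = _ := by ring

/-- The remainder at a pair of points is controlled by the mean quotients at the two points, at the
scale of their distance. -/
theorem exists_enorm_taylorRemainder_le (n k : ℕ) :
    ∃ C : ℝ≥0, ∀ F : Eucl n → FormalMultilinearSeries ℝ (Eucl n) ℝ,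
      LocallyIntegrable (fun y => F y 0 0) volume → ∀ x y : Eucl n,
      ‖taylorRemainder k F y x‖ₑ ≤ C * ‖y - x‖ₑ ^ (k + 1)
        * ((⨍⁻ z in ball x ‖y - x‖, ‖taylorRemainder k F z x‖ₑ / ‖z - x‖ₑ ^ (k + 1) ∂volume)
          + ⨍⁻ z in ball y ‖y - x‖, ‖taylorRemainder k F z y‖ₑ / ‖z - y‖ₑ ^ (k + 1) ∂volume) := by
  set M : ℕ := 2 * (k + 1) with hM
  refine ⟨∑ i ∈ Finset.range (k + 1), ((k + 1).choose (i + 1) : ℝ≥0) * (M : ℝ≥0) ^ n,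
    fun F hF x y => ?_⟩
  rcases eq_or_ne y x with rfl | hne
  · simp [taylorRemainder_self]
  set r := ‖y - x‖ with hr
  have hr0 : 0 < r := norm_pos_iff.2 (sub_ne_zero.2 hne)
  set ρ : ℝ := r / M with hρ
  have hM0 : 0 < M := by omega
  have hM0' : (0 : ℝ) < M := by exact_mod_cast hM0
  have hρ0 : 0 < ρ := by positivity
  have hMρ : M * ρ = r := by rw [hρ]; field_simp
  -- Increments near `c` point from `y` towards `x`, and have length about `r / M`.
  set c : Eucl n := (M : ℝ)⁻¹ • (x - y) with hc
  set B := ball c ρ with hB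
  have hB0 : volume B ≠ 0 := (measure_ball_pos volume c hρ0).ne'
  have hBt : volume B ≠ ⊤ := measure_ball_lt_top.ne
  -- The dilates of the ball of increments `h` stay in both balls of radius `r`.
  have hcnorm : ‖c‖ = ρ := by
    rw [hc, norm_smul, norm_inv, Real.norm_of_nonneg hM0'.le, norm_sub_rev, ← hr, hρ]
    field_simp
  have hsub : ∀ s : ℝ, 1 ≤ s → 2 * s ≤ M →
      ball (y + s • c) (s * ρ) ⊆ ball x (M * ρ) ∧ ball (y + s • c) (s * ρ) ⊆ ball y (M * ρ) := by
    intro s hs1 hs2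
    constructor
    · refine ball_subset_ball' ?_
      have h1 : y + s • c - x = (1 - s * (M : ℝ)⁻¹) • (y - x) := by
        rw [hc, smul_smul, sub_smul, one_smul, ← neg_sub y x, smul_neg]; abel
      have h2 : 0 ≤ 1 - s * (M : ℝ)⁻¹ := by
        rw [sub_nonneg, ← div_eq_mul_inv, div_le_one hM0']; linarith
      rw [dist_eq_norm, h1, norm_smul, Real.norm_of_nonneg h2, ← hr, ← hMρ]
      have h3 : (1 - s * (M : ℝ)⁻¹) * (M * ρ) = M * ρ - s * ρ := by field_simp
      rw [h3]; linarith
    · refine ball_subset_ball' ?_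
      rw [dist_eq_norm, add_sub_cancel_left, norm_smul, Real.norm_of_nonneg (by linarith), hcnorm]
      nlinarith
  set Ax := ⨍⁻ z in ball x r, ‖taylorRemainder k F z x‖ₑ / ‖z - x‖ₑ ^ (k + 1) ∂volume with hAx
  set Ay := ⨍⁻ z in ball y r, ‖taylorRemainder k F z y‖ₑ / ‖z - y‖ₑ ^ (k + 1) ∂volume with hAy
  have hmeas : ∀ (i : ℕ) (w : Eucl n), AEMeasurable
      (fun h => ‖taylorRemainder k F (y + ((i : ℝ) + 1) • h) w‖ₑ)
      ((volume B)⁻¹ • volume.restrict B) := fun i w =>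
    (((aemeasurable_enorm_taylorRemainder hF w).comp_quasiMeasurePreserving
      (quasiMeasurePreserving_add_smul volume y (by positivity))).restrict).smul_measure _
  have hadd : ∀ i : ℕ, AEMeasurable (fun h => ((k + 1).choose (i + 1) : ℝ≥0∞)
      * (‖taylorRemainder k F (y + ((i : ℝ) + 1) • h) y‖ₑ
        + ‖taylorRemainder k F (y + ((i : ℝ) + 1) • h) x‖ₑ))
      ((volume B)⁻¹ • volume.restrict B) := fun i =>
    ((hmeas i y).add (hmeas i x)).const_mul _
  calc ‖taylorRemainder k F y x‖ₑ = ⨍⁻ _h in B, ‖taylorRemainder k F y x‖ₑ ∂volume :=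
        (setLAverage_const hB0 hBt _).symm
    _ ≤ ⨍⁻ h in B, (∑ i ∈ Finset.range (k + 1), ((k + 1).choose (i + 1) : ℝ≥0∞)
          * (‖taylorRemainder k F (y + ((i : ℝ) + 1) • h) y‖ₑ
            + ‖taylorRemainder k F (y + ((i : ℝ) + 1) • h) x‖ₑ)) ∂volume := by
        rw [setLAverage_eq', setLAverage_eq']
        exact lintegral_mono fun h => enorm_taylorRemainder_le_sum k F x y h
    _ = ∑ i ∈ Finset.range (k + 1), ((k + 1).choose (i + 1) : ℝ≥0∞)
          * ((⨍⁻ h in B, ‖taylorRemainder k F (y + ((i : ℝ) + 1) • h) y‖ₑ ∂volume)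
            + ⨍⁻ h in B, ‖taylorRemainder k F (y + ((i : ℝ) + 1) • h) x‖ₑ ∂volume) := by
        simp only [setLAverage_eq']
        rw [lintegral_finsetSum' _ fun i _ => hadd i]
        refine Finset.sum_congr rfl fun i _ => ?_
        rw [lintegral_const_mul' _ _ (ENNReal.natCast_ne_top _), lintegral_add_left' (hmeas i y)]
    _ ≤ ∑ i ∈ Finset.range (k + 1), ((k + 1).choose (i + 1) : ℝ≥0∞)
          * ((M : ℝ≥0∞) ^ n * ENNReal.ofReal r ^ (k + 1) * Ay
            + (M : ℝ≥0∞) ^ n * ENNReal.ofReal r ^ (k + 1) * Ax) := by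
        refine Finset.sum_le_sum fun i hi => ?_
        have hi1 : (1 : ℝ) ≤ (i : ℝ) + 1 := by linarith [(Nat.cast_nonneg i : (0 : ℝ) ≤ i)]
        have hi2 : 2 * ((i : ℝ) + 1) ≤ M := by
          have : i + 1 ≤ k + 1 := Finset.mem_range.1 hi
          rw [hM]; push_cast
          have : (i : ℝ) + 1 ≤ k + 1 := by exact_mod_cast this
          linarith
        obtain ⟨hx, hy⟩ := hsub _ hi1 hi2
        have h1 := setLAverage_taylorRemainder_comp_le k (k + 1) F x y c hρ0 hi1 hM0 hx
        have h2 := setLAverage_taylorRemainder_comp_le k (k + 1) F y y c hρ0 hi1 hM0 hy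
        rw [hMρ] at h1 h2
        gcongr
    _ = _ := by
        have hre : ‖y - x‖ₑ = ENNReal.ofReal r := (ofReal_norm _).symm
        rw [hre]
        push_cast
        rw [Finset.sum_mul, Finset.sum_mul]
        refine Finset.sum_congr rfl fun i _ => ?_
        ring

end PointwiseEstimate

/-! ### Measurability of mean quotients -/

section Measurability

open Metric

variable {n : ℕ}

/-- The components of the jet are replaced by strongly measurable representatives, which changes the
mean quotient on a null set only. -/
theorem aemeasurable_restrictedMeanQuotient {k : ℕ} {f : Eucl n → ℝ}
    {F : Eucl n → FormalMultilinearSeries ℝ (Eucl n) ℝ} (hF : IsWeakJet k f F) (R : ℝ) :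
    AEMeasurable (restrictedMeanQuotient (k + 1) R F) volume := by
  have hmk : ∀ j : ℕ, ∃ g : Eucl n → ContinuousMultilinearMap ℝ (fun _ : Fin j => Eucl n) ℝ,
      StronglyMeasurable g ∧ (j ≤ k → (fun x => F x j) =ᵐ[volume] g) := by
    intro j
    by_cases hj : j ≤ k
    · have h := (hF.2 j hj).locallyIntegrable_deriv.aestronglyMeasurable
      exact ⟨h.mk _, h.stronglyMeasurable_mk, fun _ => h.ae_eq_mk⟩
    · exact ⟨0, stronglyMeasurable_zero, fun h => absurd h hj⟩
  choose g hgm hg using hmk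
  have hf := hF.locallyIntegrable_zero.aestronglyMeasurable
  set f₀ := hf.mk _ with hf₀
  let K : Eucl n → Eucl n → ℝ≥0∞ := fun x z =>
    ‖f₀ z - ∑ j ∈ Finset.range (k + 1), g j x (fun _ => z - x) / (j.factorial : ℝ)‖ₑ
      / ‖z - x‖ₑ ^ (k + 1)
  have hK : Measurable (Function.uncurry K) := by
    have h1 : StronglyMeasurable fun p : Eucl n × Eucl n => f₀ p.2 -
        ∑ j ∈ Finset.range (k + 1), g j p.1 (fun _ => p.2 - p.1) / (j.factorial : ℝ) := by
      simp only [div_eq_mul_inv]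
      refine (hf.stronglyMeasurable_mk.comp_measurable measurable_snd).sub
        (Finset.stronglyMeasurable_fun_sum _ fun j _ => StronglyMeasurable.mul_const ?_ _)
      have hev : Continuous fun q : ContinuousMultilinearMap ℝ (fun _ : Fin j => Eucl n) ℝ
          × (Fin j → Eucl n) => q.1 q.2 := continuous_eval
      exact hev.comp_stronglyMeasurable (((hgm j).comp_measurable measurable_fst).prodMk
        (Continuous.stronglyMeasurable (by fun_prop)))
    exact h1.measurable.enorm.div ((measurable_snd.sub measurable_fst).enorm.pow_const _)
  have hS := measurable_iSup_setLAverage_ball volume hK (S := Set.Iic R)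
    fun r hr q _ hq => hq.le.trans hr
  refine ⟨_, hS, ?_⟩
  have hall : ∀ᵐ x, ∀ j ∈ Finset.range (k + 1), F x j = g j x := by
    rw [Filter.eventually_all_finset]
    exact fun j hj => hg j (by simpa [Nat.lt_succ_iff] using hj)
  filter_upwards [hall] with x hx
  have hxz : ∀ᵐ z, ‖taylorRemainder k F z x‖ₑ / ‖z - x‖ₑ ^ (k + 1) = K x z := by
    filter_upwards [hf.ae_eq_mk] with z hz
    simp only [K, taylorRemainder, taylorField, hz]
    rw [Finset.sum_congr rfl fun j hj => by rw [hx j hj]]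
  simp only [restrictedMeanQuotient, Nat.add_sub_cancel, Set.mem_Iic]
  refine iSup_congr fun r => iSup_congr fun _ => iSup_congr fun _ => ?_
  rw [setLAverage_eq, setLAverage_eq, lintegral_congr_ae (ae_restrict_of_ae hxz)]

theorem restrictedMeanQuotient_mono (m : ℕ) {R R' : ℝ} (h : R ≤ R')
    (F : Eucl n → FormalMultilinearSeries ℝ (Eucl n) ℝ) (x : Eucl n) :
    restrictedMeanQuotient m R F x ≤ restrictedMeanQuotient m R' F x :=
  iSup₂_mono fun _ _ => iSup_const_mono fun hr => hr.trans h

theorem restrictedMeanQuotient_le_maximalMeanQuotient (m : ℕ) {R : ℝ} (hR : 0 < R)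
    (F : Eucl n → FormalMultilinearSeries ℝ (Eucl n) ℝ) (x : Eucl n) :
    restrictedMeanQuotient m R F x ≤ maximalMeanQuotient m F x :=
  le_iSup₂ (f := fun (R : ℝ) (_ : 0 < R) => restrictedMeanQuotient m R F x) R hR

theorem aemeasurable_maximalMeanQuotient {k : ℕ} {f : Eucl n → ℝ}
    {F : Eucl n → FormalMultilinearSeries ℝ (Eucl n) ℝ} (hF : IsWeakJet k f F) :
    AEMeasurable (maximalMeanQuotient (k + 1) F) volume := by
  have h : maximalMeanQuotient (k + 1) F
      = fun x => ⨆ N : ℕ, restrictedMeanQuotient (k + 1) (N + 1) F x := by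
    funext x
    apply le_antisymm
    · refine iSup₂_le fun R _ => ?_
      obtain ⟨N, hN⟩ := exists_nat_ge R
      exact le_iSup_of_le N (restrictedMeanQuotient_mono _ (by linarith) F x)
    · exact iSup_le fun N => restrictedMeanQuotient_le_maximalMeanQuotient _ (by positivity) F x
  rw [h]
  exact AEMeasurable.iSup fun N => aemeasurable_restrictedMeanQuotient hF _

end Measurability

/-! ### Comparison of norms and characterization of Sobolev functions -/

section Main

open Metric Filter

variable {n : ℕ}

theorem ae_ne_top_of_eLpNorm_lt_top {α : Type*} [MeasurableSpace α] {μ : Measure α} {p : ℝ≥0∞}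
    (hp : p ≠ 0) {g : α → ℝ≥0∞} (hg : AEMeasurable g μ) (h : eLpNorm g p μ < ⊤) :
    ∀ᵐ x ∂μ, g x ≠ ⊤ := by
  rcases eq_or_ne p ⊤ with rfl | hpt
  · filter_upwards [ENNReal.ae_le_essSup g] with x hx
    exact (hx.trans_lt (by simpa [eLpNorm_exponent_top, eLpNormEssSup] using h)).ne
  · have h1 := lintegral_rpow_enorm_lt_top_of_eLpNorm_lt_top hp hpt h
    have hp0 : 0 < p.toReal := ENNReal.toReal_pos hp hpt
    simp only [enorm_eq_self] at h1
    filter_upwards [ae_lt_top' (hg.pow_const _) h1.ne] with x hx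
    exact ((ENNReal.rpow_lt_top_iff_of_pos hp0).1 hx).ne

theorem locallyIntegrable_toReal_of_eLpNorm_lt_top {p : ℝ≥0∞} (hp : 1 ≤ p)
    {g : Eucl n → ℝ≥0∞} (hg : AEMeasurable g volume) (h : eLpNorm g p volume < ⊤) :
    LocallyIntegrable (fun x => (g x).toReal) volume := by
  have hmem : MemLp (fun x => (g x).toReal) p volume := by
    refine ⟨hg.ennreal_toReal.aestronglyMeasurable, lt_of_le_of_lt ?_ h⟩
    refine eLpNorm_mono_enorm fun x => ?_
    rw [← ofReal_norm, Real.norm_of_nonneg ENNReal.toReal_nonneg]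
    exact ENNReal.ofReal_toReal_le
  exact hmem.locallyIntegrable hp

/-- Integrability of a restricted mean quotient produces the weak derivative of order `k + 1`. -/
theorem exists_hasWeakDeriv_of_memLp {k : ℕ} {f : Eucl n → ℝ}
    {F : Eucl n → FormalMultilinearSeries ℝ (Eucl n) ℝ} (hF : IsWeakJet k f F) {p : ℝ≥0∞}
    (hp : 1 ≤ p) {R : ℝ} (hR : 0 < R)
    (h : eLpNorm (restrictedMeanQuotient (k + 1) R F) p volume < ⊤) :
    ∃ G, HasWeakDeriv (k + 1) f G := by
  obtain ⟨C, -, hC⟩ := exists_enorm_integral_mul_iteratedFDeriv_mollifier_le n k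
  have hQ := aemeasurable_restrictedMeanQuotient hF R
  have hfin := ae_ne_top_of_eLpNorm_lt_top (one_pos.trans_le hp).ne' hQ h
  obtain ⟨i₀, hi₀⟩ := eventually_atTop.1
    ((tendsto_one_div_add_atTop_nhds_zero_nat (𝕜 := ℝ)).eventually_le_const hR)
  have hf0 : (fun y => F y 0 0) = f := funext hF.1
  have hloc := locallyIntegrable_toReal_of_eLpNorm_lt_top hp hQ.measurable_mk.aemeasurable
    (by rwa [← eLpNorm_congr_ae hQ.ae_eq_mk])
  refine exists_hasWeakDeriv_of_dominated (hF.2 0 (Nat.zero_le k)).locallyIntegrable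
    (N := fun x => (C : ℝ) * (hQ.mk _ x).toReal) (hloc.smul (C : ℝ))
    (fun x => by positivity) (hQ.measurable_mk.ennreal_toReal.const_mul _) i₀
    fun i hi I => ?_
  filter_upwards [hfin, hQ.ae_eq_mk] with x hx hxm
  have hpos : 0 < 1 / ((i : ℝ) + 1) := by positivity
  have h1 := (hC F hF.locallyIntegrable_zero _ hpos x
    fun l => EuclideanSpace.single (I l) (1 : ℝ)).trans (mul_le_mul_right
      (setLAverage_le_restrictedMeanQuotient (k + 1) F x hpos (hi₀ i hi)) _)
  have hone : ∏ l : Fin (k + 1), ‖(EuclideanSpace.single (I l) (1 : ℝ) : Eucl n)‖ₑ = 1 :=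
    Finset.prod_eq_one fun l _ => by rw [← ofReal_norm]; simp
  rw [hone, mul_one] at h1
  simp only [hF.1] at h1
  rw [← hxm, ← ENNReal.coe_toReal C, ← ENNReal.toReal_mul, ← toReal_enorm]
  exact ENNReal.toReal_mono (ENNReal.mul_ne_top ENNReal.coe_ne_top hx) h1

theorem exists_eLpNorm_maximalMeanQuotient_le (hn : 1 ≤ n) (k : ℕ) {p : ℝ≥0∞} (hp : 1 < p) :
    ∃ C : ℝ≥0, ∀ (f : Eucl n → ℝ) (F : Eucl n → FormalMultilinearSeries ℝ (Eucl n) ℝ)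
      (G : Eucl n → ContinuousMultilinearMap ℝ (fun _ : Fin (k + 1) => Eucl n) ℝ),
      IsWeakJet k f F → HasWeakDeriv (k + 1) f G →
      eLpNorm (maximalMeanQuotient (k + 1) F) p volume ≤ C * eLpNorm G p volume := by
  obtain ⟨C, hC0, hC⟩ := exists_eLpNorm_maximalFunction_le (volume : Measure (Eucl n)) hp
  refine ⟨C, fun f F G hF hG => ?_⟩
  -- As `C` is positive, nothing is claimed if `G` is not in `L^p`.
  rcases eq_or_ne (eLpNorm G p volume) ⊤ with htop | htop
  · rw [htop, ENNReal.mul_top (by exact_mod_cast hC0.ne')]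
    exact le_top
  have hGm : AEMeasurable (fun y => ‖G y‖ₑ) volume :=
    hG.locallyIntegrable_deriv.aestronglyMeasurable.enorm
  have hGe : eLpNorm (fun y => ‖G y‖ₑ) p volume = eLpNorm G p volume := eLpNorm_enorm G
  have hM := hC _ hGm
  rw [hGe] at hM
  have hMfin : eLpNorm (maximalFunction volume fun y => ‖G y‖ₑ) p volume < ⊤ :=
    hM.trans_lt (ENNReal.mul_lt_top ENNReal.coe_lt_top htop.lt_top)
  have hMm := (measurable_maximalFunction volume hGm).aemeasurable (μ := volume)
  refine le_trans (eLpNorm_mono_enorm_ae ?_) hM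
  filter_upwards [ae_maximalMeanQuotient_le_maximalFunction hn hF hG
    (ae_ne_top_of_eLpNorm_lt_top (one_pos.trans hp).ne' hMm hMfin)
    (locallyIntegrable_toReal_of_eLpNorm_lt_top hp.le hMm hMfin)] with x hx
  exact hx

theorem exists_eLpNorm_weakDeriv_le (n k : ℕ) :
    ∃ C : ℝ≥0, ∀ (f : Eucl n → ℝ) (F : Eucl n → FormalMultilinearSeries ℝ (Eucl n) ℝ)
      (G : Eucl n → ContinuousMultilinearMap ℝ (fun _ : Fin (k + 1) => Eucl n) ℝ),
      IsWeakJet k f F → HasWeakDeriv (k + 1) f G → ∀ R : ℝ, 0 < R → ∀ p : ℝ≥0∞,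
      eLpNorm G p volume ≤ C * eLpNorm (restrictedMeanQuotient (k + 1) R F) p volume := by
  obtain ⟨C, -, hC⟩ := exists_enorm_weakDeriv_le_restrictedMeanQuotient n k
  refine ⟨C, fun f F G hF hG R hR p => ?_⟩
  exact eLpNorm_le_nnreal_smul_eLpNorm_of_ae_le_mul' (hC f F G hF hG R hR) p

/-- The characterization of `W^{k+1,p}` and the comparison of norms hold for any function lying
between a restricted mean quotient and the maximal mean quotient. -/
theorem memSobolev_iff_and_eLpNorm_le {k : ℕ} {p : ℝ≥0∞} (hp : 1 < p) {C C' : ℝ≥0}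
    {f : Eucl n → ℝ} {F : Eucl n → FormalMultilinearSeries ℝ (Eucl n) ℝ}
    (hf : MemSobolev k p f) (hF : IsWeakJet k f F)
    (hC : ∀ G, HasWeakDeriv (k + 1) f G → ∀ R : ℝ, 0 < R →
      eLpNorm G p volume ≤ C * eLpNorm (restrictedMeanQuotient (k + 1) R F) p volume)
    (hC' : ∀ G, HasWeakDeriv (k + 1) f G →
      eLpNorm (maximalMeanQuotient (k + 1) F) p volume ≤ C' * eLpNorm G p volume)
    {Q : Eucl n → ℝ≥0∞} (hQm : AEMeasurable Q volume) {R : ℝ} (hR : 0 < R)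
    (hRQ : ∀ x, restrictedMeanQuotient (k + 1) R F x ≤ Q x)
    (hQ : ∀ x, Q x ≤ maximalMeanQuotient (k + 1) F x) :
    (MemSobolev (k + 1) p f ↔ MemLp Q p volume) ∧
      ∀ G, HasWeakDeriv (k + 1) f G →
        eLpNorm G p volume ≤ C * eLpNorm Q p volume ∧
        eLpNorm Q p volume ≤ C' * eLpNorm G p volume := by
  have hRQ' : eLpNorm (restrictedMeanQuotient (k + 1) R F) p volume ≤ eLpNorm Q p volume :=
    eLpNorm_mono_enorm hRQ
  have hQ' : eLpNorm Q p volume ≤ eLpNorm (maximalMeanQuotient (k + 1) F) p volume :=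
    eLpNorm_mono_enorm hQ
  have hboth : ∀ G, HasWeakDeriv (k + 1) f G →
        eLpNorm G p volume ≤ C * eLpNorm Q p volume ∧
        eLpNorm Q p volume ≤ C' * eLpNorm G p volume := fun G hG =>
    ⟨(hC G hG R hR).trans (by gcongr), hQ'.trans (hC' G hG)⟩
  refine ⟨⟨fun h => ?_, fun h => ⟨hf.1, fun j hj => ?_⟩⟩, hboth⟩
  · obtain ⟨G, hG, hGp⟩ := h.2 (k + 1) le_rfl
    exact ⟨hQm.aestronglyMeasurable, (hboth G hG).2.trans_lt
      (ENNReal.mul_lt_top ENNReal.coe_lt_top hGp.2)⟩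
  · rcases Nat.le_succ_iff.1 hj with hj | rfl
    · exact hf.2 j hj
    · obtain ⟨G, hG⟩ := exists_hasWeakDeriv_of_memLp hF hp.le hR (hRQ'.trans_lt h.2)
      exact ⟨G, hG, hG.locallyIntegrable_deriv.aestronglyMeasurable,
        (hboth G hG).1.trans_lt (ENNReal.mul_lt_top ENNReal.coe_lt_top h.2)⟩

end Main

end MeanQuotient

theorem proposition2p1 (n m : ℕ) (hn : 1 ≤ n) (hm : 1 ≤ m) :
    ∃ C : ℝ≥0, ∀ p : ℝ≥0∞, 1 < p → ∃ C' : ℝ≥0,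
      ∀ (f : MeanQuotient.Eucl n → ℝ)
        (F : MeanQuotient.Eucl n → FormalMultilinearSeries ℝ (MeanQuotient.Eucl n) ℝ),
        MeanQuotient.MemSobolev (m - 1) p f → MeanQuotient.IsWeakJet (m - 1) f F →
        -- the restricted mean quotients, for every radius
        (∀ R : ℝ, 0 < R →
          (MeanQuotient.MemSobolev m p f ↔
            MemLp (MeanQuotient.restrictedMeanQuotient m R F) p volume) ∧
          (∀ G : MeanQuotient.Eucl n →
              ContinuousMultilinearMap ℝ (fun _ : Fin m => MeanQuotient.Eucl n) ℝ,
            MeanQuotient.HasWeakDeriv m f G →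
              eLpNorm G p volume
                ≤ C * eLpNorm (MeanQuotient.restrictedMeanQuotient m R F) p volume ∧
              eLpNorm (MeanQuotient.restrictedMeanQuotient m R F) p volume
                ≤ C' * eLpNorm G p volume) ∧
          (∀ x y : MeanQuotient.Eucl n, ‖y - x‖ ≤ R →
            ‖MeanQuotient.taylorRemainder (m - 1) F y x‖ₑ
              ≤ C * ‖y - x‖ₑ ^ m * (MeanQuotient.restrictedMeanQuotient m R F x
                  + MeanQuotient.restrictedMeanQuotient m R F y))) ∧
        -- the unrestricted mean quotient
        (MeanQuotient.MemSobolev m p f ↔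
            MemLp (MeanQuotient.maximalMeanQuotient m F) p volume) ∧
        (∀ G : MeanQuotient.Eucl n →
            ContinuousMultilinearMap ℝ (fun _ : Fin m => MeanQuotient.Eucl n) ℝ,
          MeanQuotient.HasWeakDeriv m f G →
            eLpNorm G p volume ≤ C * eLpNorm (MeanQuotient.maximalMeanQuotient m F) p volume ∧
            eLpNorm (MeanQuotient.maximalMeanQuotient m F) p volume
              ≤ C' * eLpNorm G p volume) ∧
        (∀ x y : MeanQuotient.Eucl n,
          ‖MeanQuotient.taylorRemainder (m - 1) F y x‖ₑ
            ≤ C * ‖y - x‖ₑ ^ m * (MeanQuotient.maximalMeanQuotient m F x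
                + MeanQuotient.maximalMeanQuotient m F y)) := by
  obtain ⟨k, rfl⟩ : ∃ k, m = k + 1 := ⟨m - 1, by omega⟩
  obtain ⟨C₁, hC₁⟩ := MeanQuotient.exists_eLpNorm_weakDeriv_le n k
  obtain ⟨C₂, hC₂⟩ := MeanQuotient.exists_enorm_taylorRemainder_le n k
  refine ⟨C₁ + C₂, fun p hp => ?_⟩
  obtain ⟨C', hC'⟩ := MeanQuotient.exists_eLpNorm_maximalMeanQuotient_le hn k hp
  refine ⟨C', fun f F hf hF => ?_⟩
  rw [Nat.add_sub_cancel] at hf hF ⊢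
  have hlower : ∀ G, MeanQuotient.HasWeakDeriv (k + 1) f G → ∀ R : ℝ, 0 < R →
      eLpNorm G p volume ≤ ((C₁ + C₂ : ℝ≥0) : ℝ≥0∞)
        * eLpNorm (MeanQuotient.restrictedMeanQuotient (k + 1) R F) p volume :=
    fun G hG R hR => (hC₁ f F G hF hG R hR p).trans
      (by gcongr; exact le_self_add)
  have hpoint : ∀ (R : ℝ) (x y : MeanQuotient.Eucl n), ‖y - x‖ ≤ R →
      ‖MeanQuotient.taylorRemainder k F y x‖ₑ
        ≤ ((C₁ + C₂ : ℝ≥0) : ℝ≥0∞) * ‖y - x‖ₑ ^ (k + 1)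
          * (MeanQuotient.restrictedMeanQuotient (k + 1) R F x
            + MeanQuotient.restrictedMeanQuotient (k + 1) R F y) := by
    intro R x y hxy
    rcases eq_or_ne y x with rfl | hne
    · simp [MeanQuotient.taylorRemainder_self]
    have hpos : 0 < ‖y - x‖ := norm_pos_iff.2 (sub_ne_zero.2 hne)
    refine (hC₂ F hF.locallyIntegrable_zero x y).trans ?_
    gcongr
    · exact le_add_self
    · exact MeanQuotient.setLAverage_le_restrictedMeanQuotient (k + 1) F x hpos hxy
    · exact MeanQuotient.setLAverage_le_restrictedMeanQuotient (k + 1) F y hpos hxy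
  refine ⟨fun R hR => ?_, ?_⟩
  · obtain ⟨h1, h2⟩ := MeanQuotient.memSobolev_iff_and_eLpNorm_le hp hf hF hlower
      (fun G hG => hC' f F G hF hG) (MeanQuotient.aemeasurable_restrictedMeanQuotient hF R) hR
      (fun _ => le_rfl)
      (MeanQuotient.restrictedMeanQuotient_le_maximalMeanQuotient (k + 1) hR F)
    exact ⟨h1, h2, hpoint R⟩
  · obtain ⟨h1, h2⟩ := MeanQuotient.memSobolev_iff_and_eLpNorm_le hp hf hF hlower
      (fun G hG => hC' f F G hF hG) (MeanQuotient.aemeasurable_maximalMeanQuotient hF) one_pos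
      (MeanQuotient.restrictedMeanQuotient_le_maximalMeanQuotient (k + 1) one_pos F)
      (fun _ => le_rfl)
    refine ⟨h1, h2, fun x y => ?_⟩
    have hpos : 0 < ‖y - x‖ + 1 := by positivity
    refine (hpoint (‖y - x‖ + 1) x y (by linarith)).trans ?_
    gcongr <;> exact MeanQuotient.restrictedMeanQuotient_le_maximalMeanQuotient (k + 1) hpos F _
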